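/- Let $n\ge 1$. For $z,w\in\mathbb C^n$ write $z=(z',z_n)$ with $z'\in\mathbb C^{n-1}$, $u^2=\sum_j u_j^2$ for $u\in\mathbb C^{n-1}$, and put $$\rho(z,w)=\tfrac14\big((z'-\overline{w'})^2-2i(z_n-\overline{w_n})\big),\qquad \rho(z)=\rho(z,z)=\operatorname{Im}z_n-|\operatorname{Im}z'|^2,$$ $$T_B=\{z\in\mathbb C^n:\ |\operatorname{Im} z'|^2<\operatorname{Im}z_n\}.$$ For $1<p<\infty$ and $\alpha>-1$, let $A^p_\alpha(T_B)$ be the space of holomorphic $f$ on $T_B$ with $\|f\|_{p,\alpha}^p=\int_{T_B}|f|^p\rho^\alpha\,dV<\infty$, where $V$ is Lebesgue measure. A positive Borel measure $\mu$ on $T_B$ is a *vanishing Carleson measure* for $A^p_\alpha(T_B)$ if $\int_{T_B}|f_k|^p\,d\mu\to0$ for every bounded sequence $(f_k)$ in $A^p_\alpha(T_B)$ that converges to $0$ uniformly on every compact subset of $T_B$. Let $K(z,w)=\frac{n!}{2^{n+1}\pi^n}\rho(z,w)^{-n-1}$ be the Bergman kernel of $T_B$ and $\mathbf B(z)=\frac1{n+1}\big(\partial^2\log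 K(z,z)/\partial\bar z_i\partial z_j\big)_{i,j}$. Let $\beta(z,w)$ be the Bergman distance, i.e. the infimum of $\int_0^1\langle\mathbf B(\gamma(t))\gamma'(t),\gamma'(t)\rangle^{1/2}dt$ over smooth curves $\gamma:[0,1]\to T_B$ from $z$ to $w$, and let $D(z,r)=\{w\in T_B:\beta(z,w)<r\}$. For $r>0$, an *$r$-lattice* is a sequence $(a_k)$ in $T_B$ such that $T_B=\bigcup_kD(a_k,r)$, the balls $D(a_k,r/4)$ are pairwise disjoint, and for some $N$ every point of $T_B$ lies in at most $N$ of the balls $D(a_k,2r)$. Finally, $a\to\partial\widehat{T_B}$ means that $\rho(a)\to0$ or $|a|\to\infty$ (convergence to $\partial T_B\cup\{\infty\}$). **Theorem.** Let $1<p<\infty$, $r>0$, $\alpha>-1$, and let $\mu$ be a positive Borel measure on $T_B$ that is finite on compact subsets of $T_B$. The following conditions are equivalent: 1. $\mu$ is a vanishing Carleson measure for $A^p_\alpha(T_B)$; 2. $\displaystyle\lim_{a\to\partial\widehat{T_B}}\int_{T_B}\frac{\rho(a)^{n+\alpha+1}}{|\rho(z,a)|^{2(n+\alpha+1)}}\,d\mu(z)=0$;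 3. $\displaystyle\lim_{a\to\partial\widehat{T_B}}\frac{\mu(D(a,r))}{\rho(a)^{n+\alpha+1}}=0$; 4. $\displaystyle\lim_{k\to\infty}\frac{\mu(D(a_k,r))}{\rho(a_k)^{n+\alpha+1}}=0$ for every $r$-lattice $(a_k)$; equivalently, for some $r$-lattice $(a_k)$. In particular, for fixed $\alpha$, condition 1 does not depend on $p\in(1,\infty)$ and condition 3 does not depend on $r>0$. -/

import Mathlib

open Filter Topology MeasureTheory Set
open scoped ENNReal NNReal ContDiff

noncomputable section

namespace TubeBergman

/-- The space of `n` complex variables with `n = m + 1 ≥ 1`. A point is split into its first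
`m = n - 1` coordinates (indexed through `Fin.castSucc`) and its last one (`Fin.last m`).
The measure `volume` on it is Lebesgue measure. -/
abbrev Cn (m : ℕ) : Type := Fin (m + 1) → ℂ

/-- The tubular domain over the paraboloid `y_1 ^ 2 + ... + y_(n-1) ^ 2 < y_n`. -/
def tubeDomain (m : ℕ) : Set (Cn m) :=
  {z | ∑ j : Fin m, (z j.castSucc).im ^ 2 < (z (Fin.last m)).im}

/-- The two-variable function `ρ(z, w)`. -/
def rho₂ {m : ℕ} (z w : Cn m) : ℂ :=
  (1 / 4) * (∑ j : Fin m, (z j.castSucc - starRingEnd ℂ (w j.castSucc)) ^ 2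
    - 2 * Complex.I * (z (Fin.last m) - starRingEnd ℂ (w (Fin.last m))))

/-- The defining function `ρ(z) = ρ(z, z)`. -/
def rho {m : ℕ} (z : Cn m) : ℝ :=
  (z (Fin.last m)).im - ∑ j : Fin m, (z j.castSucc).im ^ 2

theorem rho₂_self {m : ℕ} (z : Cn m) : rho₂ z z = (rho z : ℂ) := by
  have h (c : ℂ) : c - starRingEnd ℂ c = 2 * Complex.I * (c.im : ℂ) := by
    rw [Complex.sub_conj]; push_cast; ring
  have h2 (x : ℂ) : (2 * Complex.I * x) ^ 2 = (-4) * x ^ 2 := by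
    rw [mul_pow, mul_pow, Complex.I_sq]; ring
  simp only [rho₂, rho, h, h2, ← Finset.mul_sum]
  push_cast
  linear_combination (-(z (Fin.last m)).im : ℂ) * Complex.I_sq

/-! ### Weighted Bergman spaces -/

/-- The norm `‖f‖_{p, α}`, with the weight `ρ ^ α` and Lebesgue measure on the domain. -/
def bergmanENorm {m : ℕ} (p α : ℝ) (f : Cn m → ℂ) : ℝ≥0∞ :=
  (∫⁻ z in tubeDomain m, ‖f z‖ₑ ^ p * ENNReal.ofReal (rho z ^ α)) ^ (1 / p)

/-- `f` is holomorphic on the domain with finite norm. Only the values of `f` on the domain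
matter. -/
def MemBergman {m : ℕ} (p α : ℝ) (f : Cn m → ℂ) : Prop :=
  DifferentiableOn ℂ f (tubeDomain m) ∧ bergmanENorm p α f < ⊤

/-- `μ` is a vanishing Carleson measure for the Bergman space with parameters `p`, `α`. -/
def IsVanishingCarleson {m : ℕ} (p α : ℝ) (μ : Measure (tubeDomain m)) : Prop :=
  ∀ f : ℕ → Cn m → ℂ,
    (∀ k, MemBergman p α (f k)) →
    (∃ M : ℝ≥0, ∀ k, bergmanENorm p α (f k) ≤ M) →
    (∀ K ⊆ tubeDomain m, IsCompact K → TendstoUniformlyOn f 0 atTop K) →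
    Tendsto (fun k => ∫⁻ z, ‖f k z‖ₑ ^ p ∂μ) atTop (𝓝 0)

/-! ### The Bergman metric -/

/-- The (unweighted) Bergman kernel of the domain, `n = m + 1`. -/
def bergmanKernel {m : ℕ} (z w : Cn m) : ℂ :=
  ((m + 1).factorial : ℂ) / (2 ^ (m + 2) * (Real.pi : ℂ) ^ (m + 1) * rho₂ z w ^ (m + 2))

/-- The Wirtinger derivative `∂ / ∂ z_j = (∂ / ∂ x_j - i ∂ / ∂ y_j) / 2`. -/
def wirtinger {m : ℕ} (j : Fin (m + 1)) (f : Cn m → ℂ) (z : Cn m) : ℂ :=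
  (1 / 2) * (lineDeriv ℝ f z (Pi.single j 1)
    - Complex.I * lineDeriv ℝ f z (Pi.single j Complex.I))

/-- The conjugate Wirtinger derivative `(∂ / ∂ x_j + i ∂ / ∂ y_j) / 2`. -/
def wirtingerBar {m : ℕ} (j : Fin (m + 1)) (f : Cn m → ℂ) (z : Cn m) : ℂ :=
  (1 / 2) * (lineDeriv ℝ f z (Pi.single j 1)
    + Complex.I * lineDeriv ℝ f z (Pi.single j Complex.I))

/-- The Bergman matrix `(n + 1)⁻¹ (∂² log K(z, z) / ∂ conj(z_i) ∂ z_j)`. On the domain `K(z, z)`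
is a positive real number. -/
def bergmanMatrix {m : ℕ} (z : Cn m) : Matrix (Fin (m + 1)) (Fin (m + 1)) ℂ :=
  Matrix.of fun i j =>
    (1 / ((m : ℂ) + 2)) *
      wirtingerBar i (wirtinger j fun u => Complex.log (bergmanKernel u u)) z

/-- The Bergman length of the tangent vector `v` at `z`. -/
def bergmanSpeed {m : ℕ} (z v : Cn m) : ℝ :=
  √(star v ⬝ᵥ (bergmanMatrix z).mulVec v).re

/-- `γ`, restricted to `[0, 1]`, is a smooth curve in the domain from `z` to `w`. -/
def IsSmoothCurve {m : ℕ} (γ : ℝ → Cn m) (z w : Cn m) : Prop :=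
  ContDiffOn ℝ ∞ γ (Icc 0 1) ∧ MapsTo γ (Icc 0 1) (tubeDomain m) ∧ γ 0 = z ∧ γ 1 = w

/-- The Bergman length of a curve parametrized by `[0, 1]`. -/
def bergmanLength {m : ℕ} (γ : ℝ → Cn m) : ℝ :=
  ∫ t in (0 : ℝ)..1, bergmanSpeed (γ t) (derivWithin γ (Icc 0 1) t)

/-- The Bergman distance. -/
def bergmanDist {m : ℕ} (z w : Cn m) : ℝ :=
  sInf {l | ∃ γ, IsSmoothCurve γ z w ∧ bergmanLength γ = l}

/-- The Bergman metric ball `D(z, r)`. -/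
def bergmanBall {m : ℕ} (z : tubeDomain m) (r : ℝ) : Set (tubeDomain m) :=
  {w | bergmanDist (z : Cn m) w < r}

/-- `a` is an `r`-lattice in the Bergman metric. -/
structure IsBergmanLattice {m : ℕ} (r : ℝ) (a : ℕ → tubeDomain m) : Prop where
  cover : ⋃ k, bergmanBall (a k) r = univ
  disjoint : Pairwise fun k l => Disjoint (bergmanBall (a k) (r / 4)) (bergmanBall (a l) (r / 4))
  overlap : ∃ N : ℕ, ∀ z, {k | z ∈ bergmanBall (a k) (2 * r)}.encard ≤ N

/-! ### Convergence to the boundary and the quantities of the theorem -/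

/-- The filter of convergence to the extended boundary (the boundary of the domain together with
the point at infinity): `ρ(z) → 0` or `|z| → ∞`, where `|z|` is the Euclidean norm. -/
def boundaryFilter (m : ℕ) : Filter (tubeDomain m) :=
  comap (fun z => rho (z : Cn m)) (𝓝 0) ⊔
    comap (fun z => √(∑ i, ‖(z : Cn m) i‖ ^ 2)) atTop

/-- The integral of `ρ(a) ^ (n + α + 1) / |ρ(z, a)| ^ (2 (n + α + 1))` in `dμ(z)`, `n = m + 1`. -/
def berezinIntegral {m : ℕ} (α : ℝ) (μ : Measure (tubeDomain m)) (a : tubeDomain m) : ℝ≥0∞ :=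
  ∫⁻ z, ENNReal.ofReal (rho (a : Cn m) ^ (((m + 1 : ℕ) : ℝ) + α + 1) /
    ‖rho₂ (z : Cn m) a‖ ^ (2 * (((m + 1 : ℕ) : ℝ) + α + 1))) ∂μ

/-- The ratio `μ(D(a, r)) / ρ(a) ^ (n + α + 1)`, `n = m + 1`. -/
def ballRatio {m : ℕ} (α r : ℝ) (μ : Measure (tubeDomain m)) (a : tubeDomain m) : ℝ≥0∞ :=
  μ (bergmanBall a r) / ENNReal.ofReal (rho (a : Cn m) ^ (((m + 1 : ℕ) : ℝ) + α + 1))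

end TubeBergman

end

noncomputable section

namespace TubeBergman

/-! The domain is homogeneous. The affine maps `tubeAut a` carry the base point `(0, …, 0, i)` to
`a`, multiply `rho₂` by `rho a` (`rho₂_tubeAut`) and preserve the Bergman metric
(`bergmanDist_tubeAut`). An estimate on Bergman balls therefore only has to be made at the base
point. There, balls are trapped in compact subsets (`exists_isCompact_of_bergmanDist_lt`) and
contain Euclidean neighbourhoods (`exists_ball_subset_bergmanDist_lt`); both follow from the
explicit metric `bergmanSpeed_eq`.

Write `s = n + α + 1`. For 1 → 2, the functions `ρ(a)^(s/p) ρ(·, a)^(-2s/p)` have the Berezin kernel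
as the `p`-th power of their modulus. By homogeneity their norm does not depend on `a`; it is finite
by a Forelli–Rudin estimate, and they tend to zero locally uniformly as `a` tends to the extended
boundary. For 2 → 3, `|ρ(z, a)|` is at most a multiple of `ρ(a)` on `D(a, r)`, so the Berezin kernel
is bounded below there by a multiple of `ρ(a)^(-s)`. For 3 → 4, a lattice leaves every compact set,
and lattices exist by a maximality argument.

For 5 → 1, the sub-mean value property bounds the integral of `|f|^p dμ` over `D(a_j, r)` by the
averaged mass of that ball times the part of the Bergman norm living on `D(a_j, 2r)`. The enlarged
balls have bounded overlap, so the tail of the sum over `j` is small uniformly in `f`, while each of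
the finitely many remaining terms tends to zero by local uniform convergence. Condition 2 mentions
neither `p` nor `r`, which gives the two independence statements. -/

variable {m : ℕ}

/-! ### The defining function and the Bergman speed -/

theorem mem_tubeDomain_iff {z : Cn m} : z ∈ tubeDomain m ↔ 0 < rho z := by
  simp [tubeDomain, rho]

theorem continuous_rho : Continuous (rho : Cn m → ℝ) := by
  unfold rho; fun_prop

theorem isOpen_tubeDomain : IsOpen (tubeDomain m) := by
  have : tubeDomain m = rho ⁻¹' Ioi 0 := by ext z; exact mem_tubeDomain_iff
  rw [this]; exact isOpen_Ioi.preimage continuous_rho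

theorem measurableSet_tubeDomain : MeasurableSet (tubeDomain m) :=
  isOpen_tubeDomain.measurableSet

theorem rho_pos (a : tubeDomain m) : 0 < rho (a : Cn m) := mem_tubeDomain_iff.1 a.2

/-- The complex-linear form `v ↦ v_n - 2 ∑ y_j v_j`, a multiple of `∂ρ`. -/
def normalForm (z v : Cn m) : ℂ :=
  v (Fin.last m) - 2 * ∑ j : Fin m, ((z j.castSucc).im : ℂ) * v j.castSucc

/-- The derivative of `ρ` along the imaginary direction of the `j`-th coordinate. -/
def rhoSlope (z : Cn m) : Fin (m + 1) → ℝ :=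
  Fin.snoc (α := fun _ => ℝ) (fun j : Fin m => -2 * (z j.castSucc).im) 1

@[simp] theorem rhoSlope_castSucc (z : Cn m) (j : Fin m) :
    rhoSlope z j.castSucc = -2 * (z j.castSucc).im := by simp [rhoSlope]

@[simp] theorem rhoSlope_last (z : Cn m) : rhoSlope z (Fin.last m) = 1 := by simp [rhoSlope]

theorem normalForm_eq (z v : Cn m) : normalForm z v = ∑ j, (rhoSlope z j : ℂ) * v j := by
  rw [Fin.sum_univ_castSucc]
  simp [normalForm, Finset.mul_sum]
  rw [sub_eq_neg_add, ← Finset.sum_neg_distrib]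
  simp [mul_assoc]

theorem hasDerivAt_rho_comp {γ : ℝ → Cn m} {v : Cn m} {s : Set ℝ} {t : ℝ}
    (h : HasDerivWithinAt γ v s t) :
    HasDerivWithinAt (fun t => rho (γ t)) (normalForm (γ t) v).im s t := by
  have h1 : ∀ k, HasDerivWithinAt (fun t => (γ t k).im) (v k).im s t := fun k => by
    exact Complex.imCLM.hasFDerivAt.comp_hasDerivWithinAt t (hasDerivWithinAt_pi.1 h k)
  have h2 := (h1 (Fin.last m)).sub
    (HasDerivWithinAt.fun_sum (u := Finset.univ) fun j (_ : j ∈ Finset.univ) =>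
      (h1 (Fin.castSucc j)).fun_pow 2)
  refine (h2.congr_deriv ?_)
  simp [normalForm, Complex.im_sum, Finset.mul_sum]
  exact Finset.sum_congr rfl fun j _ => by ring

theorem hasDerivAt_add_smul (z v : Cn m) (t : ℝ) :
    HasDerivAt (fun t : ℝ => z + t • v) v t := by
  simpa using ((hasDerivAt_id t).smul_const v).const_add z

theorem hasDerivAt_rho_line (z v : Cn m) :
    HasDerivAt (fun t : ℝ => rho (z + t • v)) (normalForm z v).im 0 := by
  have := hasDerivAt_rho_comp (hasDerivAt_add_smul z v 0).hasDerivWithinAt (s := univ)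
  simpa using this

theorem normalForm_single (z : Cn m) (j : Fin (m + 1)) (c : ℂ) :
    normalForm z (Pi.single j c) = rhoSlope z j * c := by
  rw [normalForm_eq, Finset.sum_eq_single j] <;> simp +contextual

/-- On the diagonal the kernel is a positive real, so no branch problem arises and the Bergman
matrix reduces to the complex Hessian of `-log ρ`. -/
theorem log_bergmanKernel {z : Cn m} (hz : z ∈ tubeDomain m) :
    Complex.log (bergmanKernel z z) =
      ((Real.log ((m + 1).factorial / (2 ^ (m + 2) * Real.pi ^ (m + 1)))
        - (m + 2) * Real.log (rho z) : ℝ) : ℂ) := by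
  have h := mem_tubeDomain_iff.1 hz
  have hf : (0 : ℝ) < (m + 1).factorial := by exact_mod_cast Nat.factorial_pos _
  have hc : (0 : ℝ) < (m + 1).factorial / (2 ^ (m + 2) * Real.pi ^ (m + 1)) := by positivity
  have h1 : bergmanKernel z z =
      (((m + 1).factorial / (2 ^ (m + 2) * Real.pi ^ (m + 1)) / rho z ^ (m + 2) : ℝ) : ℂ) := by
    rw [bergmanKernel, rho₂_self]; push_cast; rw [div_div]
  rw [h1, ← Complex.ofReal_log (by positivity), Real.log_div hc.ne' (by positivity), Real.log_pow]
  push_cast; rfl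

theorem eventually_mem_tubeDomain {z : Cn m} (hz : z ∈ tubeDomain m) (v : Cn m) :
    ∀ᶠ t : ℝ in 𝓝 0, z + t • v ∈ tubeDomain m := by
  have : ContinuousAt (fun t : ℝ => z + t • v) 0 := by fun_prop
  exact this.eventually_mem (by simpa using isOpen_tubeDomain.mem_nhds hz)

theorem lineDeriv_log_bergmanKernel {z : Cn m} (hz : z ∈ tubeDomain m) (v : Cn m) :
    lineDeriv ℝ (fun u => Complex.log (bergmanKernel u u)) z v =
      ((-(m + 2) * ((normalForm z v).im / rho z) : ℝ) : ℂ) := by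
  have h := mem_tubeDomain_iff.1 hz
  refine HasDerivAt.deriv ?_
  have h1 := ((hasDerivAt_rho_line z v).log (by simpa using h.ne')).const_mul ((m : ℝ) + 2)
  have h2 := (h1.const_sub
    (Real.log ((m + 1).factorial / (2 ^ (m + 2) * Real.pi ^ (m + 1))))).ofReal_comp
  refine (h2.congr_deriv ?_).congr_of_eventuallyEq ?_
  · simp; ring
  · filter_upwards [eventually_mem_tubeDomain hz v] with t ht
    rw [log_bergmanKernel ht]

/-- `ρ` depends only on imaginary parts, so only the derivative in the direction `Complex.I`
contributes. -/
theorem wirtinger_log_bergmanKernel {z : Cn m} (hz : z ∈ tubeDomain m) (j : Fin (m + 1)) :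
    wirtinger j (fun u => Complex.log (bergmanKernel u u)) z =
      Complex.I * ((m + 2) / 2) * ((rhoSlope z j / rho z : ℝ) : ℂ) := by
  rw [wirtinger, lineDeriv_log_bergmanKernel hz, lineDeriv_log_bergmanKernel hz,
    normalForm_single, normalForm_single]
  simp
  ring

theorem hasDerivAt_rhoSlope_line (z v : Cn m) (j : Fin (m + 1)) :
    HasDerivAt (fun t : ℝ => rhoSlope (z + t • v) j)
      (if j = Fin.last m then 0 else -2 * (v j).im) 0 := by
  refine Fin.lastCases ?_ (fun j => ?_) j
  · simpa using hasDerivAt_const (0 : ℝ) (1 : ℝ)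
  · have h1 : HasDerivAt (fun t : ℝ => (z j.castSucc).im + t * (v j.castSucc).im)
      (v j.castSucc).im 0 := by
      simpa using ((hasDerivAt_id (0 : ℝ)).mul_const (v j.castSucc).im).const_add
        (z j.castSucc).im
    simpa [Fin.castSucc_ne_last] using h1.const_mul (-2)

theorem lineDeriv_wirtinger {z : Cn m} (hz : z ∈ tubeDomain m) (j : Fin (m + 1)) (v : Cn m) :
    lineDeriv ℝ (wirtinger j fun u => Complex.log (bergmanKernel u u)) z v =
      Complex.I * ((m + 2) / 2) *
        ((((if j = Fin.last m then 0 else -2 * (v j).im) * rho z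
          - rhoSlope z j * (normalForm z v).im) / rho z ^ 2 : ℝ) : ℂ) := by
  have h := mem_tubeDomain_iff.1 hz
  refine HasDerivAt.deriv ?_
  have h1 := (((hasDerivAt_rhoSlope_line z v j).div (hasDerivAt_rho_line z v)
    (by simpa using h.ne')).ofReal_comp).const_mul (Complex.I * (((m : ℂ) + 2) / 2))
  refine (h1.congr_deriv ?_).congr_of_eventuallyEq ?_
  · simp
  · filter_upwards [eventually_mem_tubeDomain hz v] with t ht
    rw [wirtinger_log_bergmanKernel ht]; rfl

/-- The Hessian of `-log ρ` is a rank-one term from the first derivatives of `ρ` plus a diagonal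
term from its second derivatives, which vanish in the last coordinate. -/
theorem bergmanMatrix_apply {z : Cn m} (hz : z ∈ tubeDomain m) (i j : Fin (m + 1)) :
    bergmanMatrix z i j =
      ((rhoSlope z i * rhoSlope z j / (4 * rho z ^ 2)
        + (if i = j ∧ j ≠ Fin.last m then 1 / (2 * rho z) else 0) : ℝ) : ℂ) := by
  have h : (rho z : ℂ) ≠ 0 := by exact_mod_cast (mem_tubeDomain_iff.1 hz).ne'
  have hm : (m : ℂ) + 2 ≠ 0 := by exact_mod_cast (by omega : m + 2 ≠ 0)
  rw [bergmanMatrix, Matrix.of_apply, wirtingerBar, lineDeriv_wirtinger hz, lineDeriv_wirtinger hz,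
    normalForm_single, normalForm_single]
  have h1 : ((Pi.single i (1 : ℂ) : Cn m) j).im = 0 := by
    by_cases hij : j = i
    · subst hij; simp
    · simp [hij]
  have h2 : ((Pi.single i Complex.I : Cn m) j).im = if i = j then 1 else 0 := by
    by_cases hij : i = j
    · subst hij; simp
    · simp [hij, Ne.symm hij]
  rw [h1, h2]
  by_cases hj : j = Fin.last m <;> by_cases hij : i = j <;> simp [hj, hij] <;> field_simp <;>
    simp only [Complex.I_sq] <;> ring

/-- All later facts about the metric rest on this formula: the normal component is measured at scale
`ρ`, the first `m` components at scale `√ρ`. -/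
theorem bergmanSpeed_eq {z : Cn m} (hz : z ∈ tubeDomain m) (v : Cn m) :
    bergmanSpeed z v = √(‖normalForm z v‖ ^ 2 / (4 * rho z ^ 2)
      + (∑ j : Fin m, ‖v j.castSucc‖ ^ 2) / (2 * rho z)) := by
  have key : star v ⬝ᵥ (bergmanMatrix z).mulVec v =
      ((‖normalForm z v‖ ^ 2 / (4 * rho z ^ 2)
        + (∑ j : Fin m, ‖v j.castSucc‖ ^ 2) / (2 * rho z) : ℝ) : ℂ) := by
    have e1 : star v ⬝ᵥ (bergmanMatrix z).mulVec v =
        ∑ i, ∑ j, (rhoSlope z i * star (v i)) * (rhoSlope z j * v j) * (1 / (4 * rho z ^ 2))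
        + ∑ i, ∑ j, star (v i) * v j *
          (if i = j ∧ j ≠ Fin.last m then 1 / (2 * (rho z : ℂ)) else 0) := by
      simp only [dotProduct, Matrix.mulVec, Finset.mul_sum, ← Finset.sum_add_distrib]
      refine Finset.sum_congr rfl fun i _ => Finset.sum_congr rfl fun j _ => ?_
      rw [bergmanMatrix_apply hz]
      split_ifs <;> push_cast <;> simp only [Pi.star_apply] <;> ring
    have e2 : ∑ i, ∑ j, star (v i) * v j *
        (if i = j ∧ j ≠ Fin.last m then 1 / (2 * (rho z : ℂ)) else 0) =
        (∑ j : Fin m, (‖v j.castSucc‖ : ℂ) ^ 2) / (2 * rho z) := by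
      have : ∀ i : Fin (m + 1), ∑ j, star (v i) * v j *
          (if i = j ∧ j ≠ Fin.last m then 1 / (2 * (rho z : ℂ)) else 0) =
          if i ≠ Fin.last m then (‖v i‖ : ℂ) ^ 2 / (2 * rho z) else 0 := fun i => by
        rw [Finset.sum_eq_single i]
        · rw [← Complex.conj_mul' (v i)]
          by_cases hi : i = Fin.last m <;> simp [hi]
          ring
        · intro j _ hj; simp [hj.symm]
        · simp
      simp only [this]
      rw [Fin.sum_univ_castSucc]
      simp [Fin.castSucc_ne_last, Finset.sum_div]
    have e3 : ((‖normalForm z v‖ ^ 2 : ℝ) : ℂ) =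
        ∑ i, ∑ j, (rhoSlope z i * star (v i)) * (rhoSlope z j * v j) := by
      rw [← Finset.sum_mul_sum, ← normalForm_eq z v]
      push_cast
      rw [← Complex.conj_mul', normalForm_eq, map_sum]
      simp
    rw [e1, e2, Complex.ofReal_add, Complex.ofReal_div, e3]
    push_cast
    simp only [← Finset.sum_mul]
    ring
  rw [bergmanSpeed, key, Complex.ofReal_re]

theorem bergmanSpeed_nonneg (z v : Cn m) : 0 ≤ bergmanSpeed z v := Real.sqrt_nonneg _

theorem norm_normalForm_le {z : Cn m} (hz : z ∈ tubeDomain m) (v : Cn m) :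
    ‖normalForm z v‖ ≤ 2 * rho z * bergmanSpeed z v := by
  have h := mem_tubeDomain_iff.1 hz
  rw [bergmanSpeed_eq hz]
  have h1 : ‖normalForm z v‖ / (2 * rho z) ≤ √(‖normalForm z v‖ ^ 2 / (4 * rho z ^ 2)
      + (∑ j : Fin m, ‖v j.castSucc‖ ^ 2) / (2 * rho z)) := by
    refine Real.le_sqrt_of_sq_le ?_
    have : (‖normalForm z v‖ / (2 * rho z)) ^ 2 = ‖normalForm z v‖ ^ 2 / (4 * rho z ^ 2) := by
      rw [div_pow]; ring
    rw [this]
    have : 0 ≤ (∑ j : Fin m, ‖v j.castSucc‖ ^ 2) / (2 * rho z) := by positivity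
    linarith
  rw [div_le_iff₀ (by positivity)] at h1
  linarith

theorem norm_castSucc_le {z : Cn m} (hz : z ∈ tubeDomain m) (v : Cn m) (j : Fin m) :
    ‖v j.castSucc‖ ≤ √(2 * rho z) * bergmanSpeed z v := by
  have h := mem_tubeDomain_iff.1 hz
  rw [bergmanSpeed_eq hz, ← Real.sqrt_mul (by positivity)]
  refine Real.le_sqrt_of_sq_le ?_
  have h1 : ‖v j.castSucc‖ ^ 2 ≤ ∑ j : Fin m, ‖v j.castSucc‖ ^ 2 :=
    Finset.single_le_sum (f := fun j : Fin m => ‖v j.castSucc‖ ^ 2)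
      (fun _ _ => by positivity) (Finset.mem_univ j)
  rw [mul_add, mul_div_cancel₀ _ (by positivity)]
  have : 0 ≤ 2 * rho z * (‖normalForm z v‖ ^ 2 / (4 * rho z ^ 2)) := by positivity
  linarith

/-! ### Curves and the Bergman distance -/

theorem normalForm_smul (z v : Cn m) (c : ℝ) : normalForm z (c • v) = c * normalForm z v := by
  simp only [normalForm_eq, Finset.mul_sum, Pi.smul_apply, Complex.real_smul]
  exact Finset.sum_congr rfl fun j _ => by ring

theorem bergmanSpeed_smul {z : Cn m} (hz : z ∈ tubeDomain m) (c : ℝ) (v : Cn m) :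
    bergmanSpeed z (c • v) = |c| * bergmanSpeed z v := by
  rw [bergmanSpeed_eq hz, bergmanSpeed_eq hz, ← Real.sqrt_sq_eq_abs,
    ← Real.sqrt_mul (sq_nonneg c), normalForm_smul]
  congr 1
  simp only [Pi.smul_apply, norm_smul, norm_mul, mul_pow, ← Finset.mul_sum, Complex.norm_real,
    Real.norm_eq_abs, sq_abs]
  ring

theorem continuousOn_bergmanSpeed {γ v : ℝ → Cn m} {s : Set ℝ} (hγ : ContinuousOn γ s)
    (hv : ContinuousOn v s) (hs : MapsTo γ s (tubeDomain m)) :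
    ContinuousOn (fun t => bergmanSpeed (γ t) (v t)) s := by
  refine ContinuousOn.congr (f := fun t => √(‖normalForm (γ t) (v t)‖ ^ 2 / (4 * rho (γ t) ^ 2)
      + (∑ j : Fin m, ‖v t j.castSucc‖ ^ 2) / (2 * rho (γ t)))) ?_
      fun t ht => bergmanSpeed_eq (hs ht) _
  have hp : ∀ t ∈ s, rho (γ t) ≠ 0 := fun t ht => (mem_tubeDomain_iff.1 (hs ht)).ne'
  have h1 : ContinuousOn (fun t => rho (γ t)) s := continuous_rho.comp_continuousOn hγ
  have hγ' := continuousOn_pi.1 hγ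
  have hv' := continuousOn_pi.1 hv
  have h2 : ContinuousOn (fun t => normalForm (γ t) (v t)) s := by
    unfold normalForm
    refine (hv' _).sub (continuousOn_const.mul (continuousOn_finsetSum _ fun j _ => ?_))
    exact (Complex.continuous_ofReal.comp_continuousOn
      (Complex.continuous_im.comp_continuousOn (hγ' _))).mul (hv' _)
  refine ContinuousOn.sqrt (((h2.norm.pow 2).div (continuousOn_const.mul (h1.pow 2)) fun t ht => ?_).add
    ((continuousOn_finsetSum _ fun j _ => (hv' _).norm.pow 2).div (continuousOn_const.mul h1)
      fun t ht => ?_))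
  · simpa using hp t ht
  · simpa using hp t ht

namespace IsSmoothCurve

variable {γ : ℝ → Cn m} {z w : Cn m}

theorem continuousOn_derivWithin (h : IsSmoothCurve γ z w) :
    ContinuousOn (derivWithin γ (Icc 0 1)) (Icc 0 1) :=
  h.1.continuousOn_derivWithin (uniqueDiffOn_Icc zero_lt_one) (by simp)

theorem continuousOn_speed (h : IsSmoothCurve γ z w) :
    ContinuousOn (fun t => bergmanSpeed (γ t) (derivWithin γ (Icc 0 1) t)) (Icc 0 1) :=
  continuousOn_bergmanSpeed h.1.continuousOn h.continuousOn_derivWithin h.2.1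

theorem intervalIntegrable_speed (h : IsSmoothCurve γ z w) :
    IntervalIntegrable (fun t => bergmanSpeed (γ t) (derivWithin γ (Icc 0 1) t)) volume 0 1 :=
  ContinuousOn.intervalIntegrable (by simpa using h.continuousOn_speed)

theorem hasDerivWithinAt (h : IsSmoothCurve γ z w) {t : ℝ} (ht : t ∈ Icc (0 : ℝ) 1) :
    HasDerivWithinAt γ (derivWithin γ (Icc 0 1) t) (Icc 0 1) t :=
  (h.1.differentiableOn (by simp) t ht).hasDerivWithinAt

end IsSmoothCurve

theorem bergmanLength_nonneg (γ : ℝ → Cn m) : 0 ≤ bergmanLength γ :=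
  intervalIntegral.integral_nonneg zero_le_one fun _ _ => bergmanSpeed_nonneg _ _

theorem bergmanDist_nonneg (z w : Cn m) : 0 ≤ bergmanDist z w := by
  refine Real.sInf_nonneg ?_
  rintro _ ⟨γ, -, rfl⟩
  exact bergmanLength_nonneg γ

theorem bergmanDist_le {γ : ℝ → Cn m} {z w : Cn m} (h : IsSmoothCurve γ z w) :
    bergmanDist z w ≤ bergmanLength γ := by
  refine csInf_le ⟨0, ?_⟩ ⟨γ, h, rfl⟩
  rintro _ ⟨γ, -, rfl⟩
  exact bergmanLength_nonneg γ

theorem convex_tubeDomain : Convex ℝ (tubeDomain m) := by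
  intro z hz w hw a b ha hb hab
  simp only [tubeDomain, mem_ofPred_eq] at *
  have h1 : ∑ j : Fin m, ((a • z + b • w) j.castSucc).im ^ 2 ≤
      a * ∑ j : Fin m, (z j.castSucc).im ^ 2 + b * ∑ j : Fin m, (w j.castSucc).im ^ 2 := by
    rw [Finset.mul_sum, Finset.mul_sum, ← Finset.sum_add_distrib]
    refine Finset.sum_le_sum fun j _ => ?_
    obtain rfl : b = 1 - a := by linarith
    simp
    nlinarith [mul_nonneg (mul_nonneg ha hb)
      (sq_nonneg ((z j.castSucc).im - (w j.castSucc).im))]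
  refine h1.trans_lt ?_
  simp
  rcases ha.eq_or_lt with rfl | ha
  · have : b = 1 := by linarith
    subst this; simpa using hw
  · nlinarith [mul_lt_mul_of_pos_left hz ha, mul_le_mul_of_nonneg_left hw.le hb]

theorem isSmoothCurve_segment {z w : Cn m} (hz : z ∈ tubeDomain m) (hw : w ∈ tubeDomain m) :
    IsSmoothCurve (fun t : ℝ => z + t • (w - z)) z w := by
  refine ⟨?_, fun t ht => ?_, by simp, by simp⟩
  · exact (contDiff_const.add (contDiff_id.smul contDiff_const)).contDiffOn
  · exact convex_tubeDomain.add_smul_sub_mem hz hw ht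

theorem exists_curve_of_bergmanDist_lt {z w : Cn m} (hz : z ∈ tubeDomain m)
    (hw : w ∈ tubeDomain m) {r : ℝ} (h : bergmanDist z w < r) :
    ∃ γ, IsSmoothCurve γ z w ∧ bergmanLength γ < r := by
  have hne : {l | ∃ γ, IsSmoothCurve γ z w ∧ bergmanLength γ = l}.Nonempty :=
    ⟨_, _, isSmoothCurve_segment hz hw, rfl⟩
  obtain ⟨_, ⟨γ, hγ, rfl⟩, hr⟩ := exists_lt_of_csInf_lt hne h
  exact ⟨γ, hγ, hr⟩

theorem bergmanDist_self {z : Cn m} (hz : z ∈ tubeDomain m) : bergmanDist z z = 0 := by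
  refine le_antisymm ?_ (bergmanDist_nonneg z z)
  refine (bergmanDist_le (isSmoothCurve_segment hz hz)).trans (le_of_eq ?_)
  have : bergmanSpeed z (0 : Cn m) = 0 := by
    have := bergmanSpeed_smul hz 0 (0 : Cn m)
    rwa [smul_zero, abs_zero, zero_mul] at this
  simp [bergmanLength] at this ⊢
  exact this

/-! ### Smooth reparametrization and gluing of curves. -/

section Reparametrization

variable {γ : ℝ → Cn m} {z w : Cn m} {θ : ℝ → ℝ}

/-- A parameter change with values in `[0, 1]` yields a curve smooth on all of `ℝ`, so one-sided
derivatives at the endpoints disappear. -/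
theorem IsSmoothCurve.contDiff_comp (h : IsSmoothCurve γ z w) (hθ : ContDiff ℝ ∞ θ)
    (hm : ∀ t, θ t ∈ Icc (0 : ℝ) 1) : ContDiff ℝ ∞ (γ ∘ θ) :=
  contDiffOn_univ.1 (h.1.comp hθ.contDiffOn fun t _ => hm t)

theorem IsSmoothCurve.speed_comp (h : IsSmoothCurve γ z w) (hθ : ContDiff ℝ ∞ θ)
    (hm : ∀ t, θ t ∈ Icc (0 : ℝ) 1) (t : ℝ) :
    bergmanSpeed ((γ ∘ θ) t) (deriv (γ ∘ θ) t) =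
      |deriv θ t| * bergmanSpeed (γ (θ t)) (derivWithin γ (Icc 0 1) (θ t)) := by
  have h1 : HasDerivAt (γ ∘ θ) (deriv θ t • derivWithin γ (Icc 0 1) (θ t)) t := by
    have := (h.hasDerivWithinAt (hm t)).scomp t
      ((hθ.differentiable (by simp)) t).hasDerivAt.hasDerivWithinAt (s := univ)
      (fun t _ => hm t)
    simpa using this
  rw [h1.deriv, Function.comp_apply, bergmanSpeed_smul (h.2.1 (hm t))]

theorem IsSmoothCurve.integral_speed_comp (h : IsSmoothCurve γ z w) (hθ : ContDiff ℝ ∞ θ)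
    (hm : ∀ t, θ t ∈ Icc (0 : ℝ) 1) (a b : ℝ) :
    ∫ t in a..b, deriv θ t * bergmanSpeed (γ (θ t)) (derivWithin γ (Icc 0 1) (θ t)) =
      ∫ t in θ a..θ b, bergmanSpeed (γ t) (derivWithin γ (Icc 0 1) t) := by
  rw [← intervalIntegral.integral_comp_mul_deriv'''
    (g := fun t => bergmanSpeed (γ t) (derivWithin γ (Icc 0 1) t)) (f := θ) (f' := deriv θ)]
  · exact intervalIntegral.integral_congr fun t _ => mul_comm _ _
  · exact hθ.continuous.continuousOn
  · exact fun t _ => ((hθ.differentiable (by simp)) t).hasDerivAt.hasDerivWithinAt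
  · exact h.continuousOn_speed.mono (by rintro _ ⟨t, -, rfl⟩; exact hm t)
  · refine (ContinuousOn.integrableOn_compact
      (isCompact_uIcc.image_of_continuousOn hθ.continuous.continuousOn) ?_)
    exact (h.continuousOn_speed.mono (by rintro _ ⟨t, -, rfl⟩; exact hm t))
  · refine (ContinuousOn.integrableOn_compact isCompact_uIcc ?_)
    have : Continuous (fun t => bergmanSpeed (γ (θ t)) (derivWithin γ (Icc 0 1) (θ t))) :=
      continuousOn_univ.1 (h.continuousOn_speed.comp hθ.continuous.continuousOn fun t _ => hm t)
    exact (this.mul (hθ.continuous_deriv (by simp))).continuousOn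

theorem bergmanLength_eq_of_differentiable {δ : ℝ → Cn m} (h : Differentiable ℝ δ) :
    bergmanLength δ = ∫ t in (0 : ℝ)..1, bergmanSpeed (δ t) (deriv δ t) := by
  refine intervalIntegral.integral_congr fun t ht => ?_
  rw [uIcc_of_le zero_le_one] at ht
  rw [(h t).derivWithin (uniqueDiffOn_Icc zero_lt_one t ht)]

end Reparametrization

theorem bergmanDist_comm_le {z w : Cn m} (hz : z ∈ tubeDomain m) (hw : w ∈ tubeDomain m) :
    bergmanDist w z ≤ bergmanDist z w := by
  refine le_of_forall_gt_imp_ge_of_dense fun r hr => ?_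
  obtain ⟨γ, hγ, hr⟩ := exists_curve_of_bergmanDist_lt hz hw hr
  set θ : ℝ → ℝ := fun t => Real.smoothTransition (1 - t) with hθdef
  have hθ : ContDiff ℝ ∞ θ :=
    Real.smoothTransition.contDiff.comp (contDiff_const.sub contDiff_id)
  have hm : ∀ t, θ t ∈ Icc (0 : ℝ) 1 := fun t =>
    ⟨Real.smoothTransition.nonneg _, Real.smoothTransition.le_one _⟩
  have hanti : Antitone θ := fun s t hst =>
    Real.smoothTransition.monotone (by linarith)
  have hc := hγ.contDiff_comp hθ hm
  have hs : IsSmoothCurve (γ ∘ θ) w z :=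
    ⟨hc.contDiffOn, fun t _ => hγ.2.1 (hm t), by simp [hθdef, hγ.2.2.2],
      by simp [hθdef, hγ.2.2.1]⟩
  refine (bergmanDist_le hs).trans (le_trans (le_of_eq ?_) hr.le)
  rw [bergmanLength_eq_of_differentiable (hc.differentiable (by simp))]
  have : ∀ t, bergmanSpeed ((γ ∘ θ) t) (deriv (γ ∘ θ) t) =
      -(deriv θ t * bergmanSpeed (γ (θ t)) (derivWithin γ (Icc 0 1) (θ t))) := fun t => by
    rw [hγ.speed_comp hθ hm, abs_of_nonpos hanti.deriv_nonpos, neg_mul]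
  simp only [this, intervalIntegral.integral_neg, hγ.integral_speed_comp hθ hm]
  rw [intervalIntegral.integral_symm]
  simp [hθdef, bergmanLength]

theorem bergmanDist_comm {z w : Cn m} (hz : z ∈ tubeDomain m) (hw : w ∈ tubeDomain m) :
    bergmanDist z w = bergmanDist w z :=
  le_antisymm (bergmanDist_comm_le hw hz) (bergmanDist_comm_le hz hw)

/-- Admissible curves are smooth, not piecewise smooth, so a concatenation could have a corner. Both
curves are reparametrized to rest at `w` around the junction. -/
theorem bergmanDist_triangle {z w u : Cn m} (hz : z ∈ tubeDomain m) (hw : w ∈ tubeDomain m)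
    (hu : u ∈ tubeDomain m) : bergmanDist z u ≤ bergmanDist z w + bergmanDist w u := by
  refine le_of_forall_pos_le_add fun ε hε => ?_
  obtain ⟨γ₁, h₁, hr₁⟩ := exists_curve_of_bergmanDist_lt hz hw
    (show bergmanDist z w < bergmanDist z w + ε / 2 by linarith)
  obtain ⟨γ₂, h₂, hr₂⟩ := exists_curve_of_bergmanDist_lt hw hu
    (show bergmanDist w u < bergmanDist w u + ε / 2 by linarith)
  set θ₁ : ℝ → ℝ := fun t => Real.smoothTransition (3 * t) with hθ₁def
  set θ₂ : ℝ → ℝ := fun t => Real.smoothTransition (3 * t - 2) with hθ₂def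
  have hθ₁ : ContDiff ℝ ∞ θ₁ :=
    Real.smoothTransition.contDiff.comp (contDiff_const.mul contDiff_id)
  have hθ₂ : ContDiff ℝ ∞ θ₂ :=
    Real.smoothTransition.contDiff.comp ((contDiff_const.mul contDiff_id).sub contDiff_const)
  have hm₁ : ∀ t, θ₁ t ∈ Icc (0 : ℝ) 1 := fun t =>
    ⟨Real.smoothTransition.nonneg _, Real.smoothTransition.le_one _⟩
  have hm₂ : ∀ t, θ₂ t ∈ Icc (0 : ℝ) 1 := fun t =>
    ⟨Real.smoothTransition.nonneg _, Real.smoothTransition.le_one _⟩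
  have hmono₁ : Monotone θ₁ := fun s t hst => Real.smoothTransition.monotone (by linarith)
  have hmono₂ : Monotone θ₂ := fun s t hst => Real.smoothTransition.monotone (by linarith)
  have hone : ∀ t, 1 / 3 ≤ t → θ₁ t = 1 := fun t ht =>
    Real.smoothTransition.one_of_one_le (by linarith)
  have hzero : ∀ t, t ≤ 2 / 3 → θ₂ t = 0 := fun t ht =>
    Real.smoothTransition.zero_of_nonpos (by linarith)
  set η : ℝ → Cn m := fun t => if t < 1 / 2 then γ₁ (θ₁ t) else γ₂ (θ₂ t) with hηdef
  -- On `[1/3, 2/3]` the first curve has arrived at `w` and the second has not left it; this overlap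
  -- makes `η` smooth at `1/2`.
  have e₁ : ∀ t < 2 / 3, η t = (γ₁ ∘ θ₁) t := fun t ht => by
    by_cases h : t < 1 / 2
    · simp only [hηdef, h, if_true, Function.comp]
    · simp only [hηdef, h, if_false, Function.comp]
      rw [hzero t ht.le, hone t (by linarith), h₁.2.2.2, h₂.2.2.1]
  have e₂ : ∀ t, 1 / 3 < t → η t = (γ₂ ∘ θ₂) t := fun t ht => by
    by_cases h : t < 1 / 2
    · simp only [hηdef, h, if_true, Function.comp]
      rw [hzero t (by linarith), hone t ht.le, h₁.2.2.2, h₂.2.2.1]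
    · simp only [hηdef, h, if_false, Function.comp]
  have g₁ : ∀ t < 2 / 3, η =ᶠ[𝓝 t] γ₁ ∘ θ₁ := fun t ht => by
    filter_upwards [Iio_mem_nhds ht] with s hs using e₁ s hs
  have g₂ : ∀ t, 1 / 3 < t → η =ᶠ[𝓝 t] γ₂ ∘ θ₂ := fun t ht => by
    filter_upwards [Ioi_mem_nhds ht] with s hs using e₂ s hs
  have c₁ := h₁.contDiff_comp hθ₁ hm₁
  have c₂ := h₂.contDiff_comp hθ₂ hm₂
  have hη : ContDiff ℝ ∞ η := contDiff_iff_contDiffAt.2 fun t => by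
    rcases lt_or_ge t (1 / 2) with h | h
    · exact c₁.contDiffAt.congr_of_eventuallyEq (g₁ t (by linarith))
    · exact c₂.contDiffAt.congr_of_eventuallyEq (g₂ t (by linarith))
  have hs : IsSmoothCurve η z u := by
    refine ⟨hη.contDiffOn, fun t _ => ?_, ?_, ?_⟩
    · simp only [hηdef]
      split_ifs
      exacts [h₁.2.1 (hm₁ t), h₂.2.1 (hm₂ t)]
    · rw [e₁ 0 (by norm_num)]; simp [hθ₁def, h₁.2.2.1]
    · rw [e₂ 1 (by norm_num)]
      simp only [hθ₂def, Function.comp]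
      rw [Real.smoothTransition.one_of_one_le (by norm_num), h₂.2.2.2]
  have hcont : Continuous fun t => bergmanSpeed (η t) (deriv η t) := by
    refine continuousOn_univ.1 (continuousOn_bergmanSpeed hη.continuous.continuousOn
      (hη.continuous_deriv (by simp)).continuousOn fun t _ => ?_)
    simp only [hηdef]
    split_ifs
    exacts [h₁.2.1 (hm₁ t), h₂.2.1 (hm₂ t)]
  have l₁ : ∫ t in (0 : ℝ)..(1 / 2), bergmanSpeed (η t) (deriv η t) = bergmanLength γ₁ := by
    have : ∀ t ∈ uIcc (0 : ℝ) (1 / 2), bergmanSpeed (η t) (deriv η t) =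
        deriv θ₁ t * bergmanSpeed (γ₁ (θ₁ t)) (derivWithin γ₁ (Icc 0 1) (θ₁ t)) := fun t ht => by
      rw [uIcc_of_le (by norm_num)] at ht
      have ht' : t < 2 / 3 := by linarith [ht.2]
      rw [(g₁ t ht').deriv_eq, e₁ t ht', h₁.speed_comp hθ₁ hm₁,
        abs_of_nonneg hmono₁.deriv_nonneg]
    rw [intervalIntegral.integral_congr this, h₁.integral_speed_comp hθ₁ hm₁,
      hone (1 / 2) (by norm_num)]
    simp [hθ₁def, bergmanLength]
  have l₂ : ∫ t in (1 / 2 : ℝ)..1, bergmanSpeed (η t) (deriv η t) = bergmanLength γ₂ := by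
    have : ∀ t ∈ uIcc (1 / 2 : ℝ) 1, bergmanSpeed (η t) (deriv η t) =
        deriv θ₂ t * bergmanSpeed (γ₂ (θ₂ t)) (derivWithin γ₂ (Icc 0 1) (θ₂ t)) := fun t ht => by
      rw [uIcc_of_le (by norm_num)] at ht
      have ht' : 1 / 3 < t := by linarith [ht.1]
      rw [(g₂ t ht').deriv_eq, e₂ t ht', h₂.speed_comp hθ₂ hm₂,
        abs_of_nonneg hmono₂.deriv_nonneg]
    rw [intervalIntegral.integral_congr this, h₂.integral_speed_comp hθ₂ hm₂,
      hzero (1 / 2) (by norm_num)]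
    simp only [hθ₂def, bergmanLength]
    rw [Real.smoothTransition.one_of_one_le (by norm_num)]
  have := bergmanDist_le hs
  rw [bergmanLength_eq_of_differentiable (hη.differentiable (by simp)),
    ← intervalIntegral.integral_add_adjacent_intervals
      (hcont.intervalIntegrable 0 (1 / 2)) (hcont.intervalIntegrable (1 / 2) 1), l₁, l₂] at this
  linarith

/-! ### Bergman balls around the base point -/

/-- A function on `[0, 1]` whose derivative is bounded by a multiple of a continuous function moves
by at most that multiple of its integral. -/
theorem norm_sub_le_mul_integral {E : Type*} [NormedAddCommGroup E] [NormedSpace ℝ E]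
    {H H' : ℝ → E} {S : ℝ → ℝ} {C : ℝ} (hC : 0 ≤ C) (hS : ContinuousOn S (Icc 0 1))
    (hS0 : ∀ t, 0 ≤ S t)
    (hH : ∀ t ∈ Icc (0 : ℝ) 1, HasDerivWithinAt H (H' t) (Icc 0 1) t)
    (hb : ∀ t ∈ Icc (0 : ℝ) 1, ‖H' t‖ ≤ C * S t) {t : ℝ} (ht : t ∈ Icc (0 : ℝ) 1) :
    ‖H t - H 0‖ ≤ C * ∫ t in (0 : ℝ)..1, S t := by
  -- Continuity on all of `ℝ` makes the primitive of the bound differentiable everywhere, as the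
  -- comparison lemma requires.
  set S' : ℝ → ℝ := IccExtend zero_le_one ((Icc (0 : ℝ) 1).domRestrict S) with hS'
  have hc : Continuous S' := hS.domRestrict.Icc_extend'
  have heq : ∀ s ∈ Icc (0 : ℝ) 1, S' s = S s := fun s hs => by
    rw [hS', IccExtend_of_mem _ _ hs, domRestrict_apply]
  have hnn : ∀ s, 0 ≤ S' s := fun s => hS0 _
  have h1 : ‖H t - H 0‖ ≤ C * ∫ s in (0 : ℝ)..t, S' s := by
    refine image_norm_le_of_norm_deriv_right_le_deriv_boundary
      (f := fun t => H t - H 0) (f' := H') (a := 0) (b := 1)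
      (B := fun t => C * ∫ s in (0 : ℝ)..t, S' s) (B' := fun t => C * S' t)
      ?_ ?_ ?_ ?_ ?_ ht
    · exact (fun s hs => (hH s hs).continuousWithinAt.sub continuousWithinAt_const)
    · intro s hs
      have := ((hH s ⟨hs.1, hs.2.le⟩).sub_const (H 0))
      exact (this.mono_of_mem_nhdsWithin (Icc_mem_nhdsGE_of_mem hs))
    · simp
    · exact fun s => ((hc.integral_hasStrictDerivAt 0 s).hasDerivAt).const_mul C
    · intro s hs
      rw [heq s ⟨hs.1, hs.2.le⟩]
      exact hb s ⟨hs.1, hs.2.le⟩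
  refine h1.trans (mul_le_mul_of_nonneg_left ?_ hC)
  have h2 : ∫ s in (0 : ℝ)..1, S s = ∫ s in (0 : ℝ)..1, S' s :=
    intervalIntegral.integral_congr fun s hs => by
      rw [uIcc_of_le zero_le_one] at hs; exact (heq s hs).symm
  rw [h2, ← intervalIntegral.integral_add_adjacent_intervals
    (hc.intervalIntegrable 0 t) (hc.intervalIntegrable t 1)]
  have : 0 ≤ ∫ s in t..1, S' s := intervalIntegral.integral_nonneg ht.2 fun s _ => hnn s
  linarith

/-- The point `(0, …, 0, i)`. -/
def basePoint (m : ℕ) : Cn m := Pi.single (Fin.last m) Complex.I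

@[simp] theorem basePoint_castSucc (j : Fin m) : basePoint m j.castSucc = 0 := by
  simp [basePoint, Fin.castSucc_ne_last]

@[simp] theorem basePoint_last : basePoint m (Fin.last m) = Complex.I := by simp [basePoint]

@[simp] theorem rho_basePoint : rho (basePoint m) = 1 := by simp [rho]

theorem basePoint_mem : basePoint m ∈ tubeDomain m := by simp [mem_tubeDomain_iff]

/-- The derivative of `log ρ` along a curve is `Im (normalForm) / ρ`, at most twice the Bergman
speed. -/
theorem abs_log_rho_le {γ : ℝ → Cn m} {w : Cn m} (h : IsSmoothCurve γ (basePoint m) w) {t : ℝ}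
    (ht : t ∈ Icc (0 : ℝ) 1) : |Real.log (rho (γ t))| ≤ 2 * bergmanLength γ := by
  have := norm_sub_le_mul_integral (H := fun t => Real.log (rho (γ t))) zero_le_two
    h.continuousOn_speed (fun _ => bergmanSpeed_nonneg _ _)
    (fun s hs => (hasDerivAt_rho_comp (h.hasDerivWithinAt hs)).log
      (mem_tubeDomain_iff.1 (h.2.1 hs)).ne') (fun s hs => ?_) ht
  · simpa [h.2.2.1, bergmanLength] using this
  · have hp := mem_tubeDomain_iff.1 (h.2.1 hs)
    rw [norm_div, Real.norm_of_nonneg hp.le, div_le_iff₀ hp]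
    refine (Complex.abs_im_le_norm _).trans ((norm_normalForm_le (h.2.1 hs) _).trans (le_of_eq ?_))
    ring

/-- Along a curve of length below `r`, `log ρ` stays bounded, so the curve keeps away from the
boundary. Euclidean speed is then controlled by Bergman speed, first in the coordinates `castSucc`
and then in the last one. -/
theorem exists_isCompact_of_bergmanDist_lt (m : ℕ) (r : ℝ) :
    ∃ K ⊆ tubeDomain m, IsCompact K ∧
      ∀ w ∈ tubeDomain m, bergmanDist (basePoint m) w < r → w ∈ K := by
  -- `E` bounds `ρ` and `1/ρ` on the curve, `A` the first `m` coordinates, and `M` the displacement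
  -- of the last coordinate from `i`.
  set E := Real.exp (2 * r) with hE
  set A := √(2 * E) * r with hA
  set M := (2 * E + 2 * ∑ _j : Fin m, A * √(2 * E)) * r with hM
  have hE0 : 0 < E := Real.exp_pos _
  refine ⟨{w | E⁻¹ ≤ rho w} ∩ Metric.closedBall 0 (max A (1 + M)), ?_, ?_, ?_⟩
  · rintro w ⟨hw, -⟩
    exact mem_tubeDomain_iff.2 (lt_of_lt_of_le (by positivity) hw)
  · exact (isCompact_closedBall _ _).inter_left (isClosed_le continuous_const continuous_rho)
  intro w hw hr
  obtain ⟨γ, h, hl⟩ := exists_curve_of_bergmanDist_lt basePoint_mem hw hr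
  have hr0 : 0 < r := (bergmanLength_nonneg γ).trans_lt hl
  have hA0 : 0 ≤ A := by positivity
  have hlog : ∀ t ∈ Icc (0 : ℝ) 1, |Real.log (rho (γ t))| ≤ 2 * r := fun t ht =>
    (abs_log_rho_le h ht).trans (by linarith)
  have hup : ∀ t ∈ Icc (0 : ℝ) 1, rho (γ t) ≤ E := fun t ht => by
    rw [hE, ← Real.log_le_iff_le_exp (mem_tubeDomain_iff.1 (h.2.1 ht))]
    exact (abs_le.1 (hlog t ht)).2
  have hlow : ∀ t ∈ Icc (0 : ℝ) 1, E⁻¹ ≤ rho (γ t) := fun t ht => by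
    rw [hE, ← Real.exp_neg, ← Real.le_log_iff_exp_le (mem_tubeDomain_iff.1 (h.2.1 ht))]
    exact (abs_le.1 (hlog t ht)).1
  have hint : ∫ t in (0 : ℝ)..1, bergmanSpeed (γ t) (derivWithin γ (Icc 0 1) t) ≤ r := hl.le
  have hv : ∀ t ∈ Icc (0 : ℝ) 1, ∀ j : Fin m, ‖derivWithin γ (Icc 0 1) t j.castSucc‖ ≤
      √(2 * E) * bergmanSpeed (γ t) (derivWithin γ (Icc 0 1) t) := fun t ht j => by
    refine (norm_castSucc_le (h.2.1 ht) _ j).trans ?_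
    have := hup t ht
    have := bergmanSpeed_nonneg (γ t) (derivWithin γ (Icc 0 1) t)
    gcongr
  have hj : ∀ t ∈ Icc (0 : ℝ) 1, ∀ j : Fin m, ‖γ t j.castSucc‖ ≤ A := fun t ht j => by
    have := norm_sub_le_mul_integral (H := fun t => γ t j.castSucc) (C := √(2 * E))
      (by positivity) h.continuousOn_speed (fun _ => bergmanSpeed_nonneg _ _)
      (fun s hs => hasDerivWithinAt_pi.1 (h.hasDerivWithinAt hs) _) (fun s hs => hv s hs j) ht
    simp only [h.2.2.1, basePoint_castSucc, sub_zero] at this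
    exact this.trans (by rw [hA]; gcongr)
  have hn : ‖w (Fin.last m) - Complex.I‖ ≤ M := by
    have := norm_sub_le_mul_integral (H := fun t => γ t (Fin.last m))
      (C := 2 * E + 2 * ∑ _j : Fin m, A * √(2 * E))
      (by positivity) h.continuousOn_speed (fun _ => bergmanSpeed_nonneg _ _)
      (fun s hs => hasDerivWithinAt_pi.1 (h.hasDerivWithinAt hs) _) (fun s hs => ?_)
      (right_mem_Icc.2 zero_le_one)
    · simp only [h.2.2.1, h.2.2.2, basePoint_last] at this
      exact this.trans (by rw [hM]; gcongr)
    -- The metric controls only the normal combination of the components, so the tangential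
    -- correction is added back; this is why `A` is needed before `M`.
    · have e : derivWithin γ (Icc 0 1) s (Fin.last m) =
          normalForm (γ s) (derivWithin γ (Icc 0 1) s)
          + 2 * ∑ j : Fin m, ((γ s j.castSucc).im : ℂ) * derivWithin γ (Icc 0 1) s j.castSucc := by
        rw [normalForm]; ring
      have hS := bergmanSpeed_nonneg (γ s) (derivWithin γ (Icc 0 1) s)
      have h1 := norm_normalForm_le (h.2.1 hs) (derivWithin γ (Icc 0 1) s)
      have h2 : 2 * rho (γ s) * bergmanSpeed (γ s) (derivWithin γ (Icc 0 1) s) ≤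
          2 * E * bergmanSpeed (γ s) (derivWithin γ (Icc 0 1) s) := by
        have := hup s hs; gcongr
      have h3 : ‖∑ j : Fin m, ((γ s j.castSucc).im : ℂ) *
            derivWithin γ (Icc 0 1) s j.castSucc‖ ≤
          ∑ _j : Fin m, A * √(2 * E) * bergmanSpeed (γ s) (derivWithin γ (Icc 0 1) s) := by
        refine norm_sum_le_of_le _ fun j _ => ?_
        rw [norm_mul, Complex.norm_real, mul_assoc]
        have := (Complex.abs_im_le_norm _).trans (hj s hs j)
        have := hv s hs j
        gcongr
        assumption
      rw [e]
      refine (norm_add_le _ _).trans ?_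
      rw [norm_mul, Complex.norm_two, add_mul, mul_assoc 2 (∑ _j : Fin m, _), Finset.sum_mul]
      linarith
  refine ⟨by simpa [h.2.2.2] using hlow 1 (right_mem_Icc.2 zero_le_one), ?_⟩
  rw [mem_closedBall_zero_iff, pi_norm_le_iff_of_nonneg (le_max_of_le_left hA0)]
  intro k
  refine Fin.lastCases ?_ (fun j => ?_) k
  · refine le_max_of_le_right ?_
    calc ‖w (Fin.last m)‖ = ‖Complex.I + (w (Fin.last m) - Complex.I)‖ := by ring_nf
      _ ≤ 1 + M := (norm_add_le _ _).trans (by rw [Complex.norm_I]; linarith)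
  · refine le_max_of_le_left ?_
    simpa [h.2.2.2] using hj 1 (right_mem_Icc.2 zero_le_one) j

/-- Near the base point `ρ` is close to `1`, so Bergman speed is at most a multiple of the Euclidean
one, and straight segments are short. -/
theorem exists_ball_subset_bergmanDist_lt (m : ℕ) {r : ℝ} (hr : 0 < r) :
    ∃ ε > 0, ∀ w ∈ Metric.ball (basePoint m) ε,
      w ∈ tubeDomain m ∧ bergmanDist (basePoint m) w < r ∧ rho w ∈ Icc (1 / 2 : ℝ) 2 := by
  obtain ⟨ε₀, hε₀, hb⟩ := Metric.mem_nhds_iff.1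
    (continuous_rho.continuousAt.preimage_mem_nhds
      (t := Icc (1 / 2 : ℝ) 2) (x := basePoint m) (by
        rw [rho_basePoint]; exact Icc_mem_nhds (by norm_num) (by norm_num)))
  -- Chosen so that `(1 + 2m)² + m ≤ C²`: the first term bounds the normal part of the metric when
  -- `|y_j| ≤ 1`, the second the tangential part.
  set C : ℝ := 2 + 4 * m with hC
  have hC0 : 0 < C := by positivity
  set ε := min (min ε₀ 1) (r / C) with hε
  have hε0 : 0 < ε := by positivity
  have hrho : ∀ w ∈ Metric.ball (basePoint m) ε, rho w ∈ Icc (1 / 2 : ℝ) 2 := fun w hw =>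
    hb (Metric.ball_subset_ball ((min_le_left _ _).trans (min_le_left _ _)) hw)
  have hT : ∀ w ∈ Metric.ball (basePoint m) ε, w ∈ tubeDomain m := fun w hw =>
    mem_tubeDomain_iff.2 (lt_of_lt_of_le (by norm_num) (hrho w hw).1)
  refine ⟨ε, hε0, fun w hw => ⟨hT w hw, ?_, hrho w hw⟩⟩
  have hcurve := isSmoothCurve_segment basePoint_mem (hT w hw)
  refine (bergmanDist_le hcurve).trans_lt ?_
  have hv : ‖w - basePoint m‖ < ε := by simpa [dist_eq_norm] using hw
  have hbound : ∀ t ∈ Icc (0 : ℝ) 1,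
      bergmanSpeed (basePoint m + t • (w - basePoint m))
        (derivWithin (fun t : ℝ => basePoint m + t • (w - basePoint m)) (Icc 0 1) t) ≤
      C * ‖w - basePoint m‖ := fun t ht => by
    rw [(hasDerivAt_add_smul _ _ t).hasDerivWithinAt.derivWithin
      (uniqueDiffOn_Icc zero_lt_one t ht)]
    have hz : basePoint m + t • (w - basePoint m) ∈ Metric.ball (basePoint m) ε :=
      (convex_ball _ _).add_smul_sub_mem (Metric.mem_ball_self hε0) hw ht
    set z := basePoint m + t • (w - basePoint m) with hzdef
    set v := w - basePoint m
    have hρ := (hrho z hz).1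
    rw [bergmanSpeed_eq (hT z hz)]
    refine Real.sqrt_le_iff.2 ⟨by positivity, ?_⟩
    have hvk : ∀ k, ‖v k‖ ≤ ‖v‖ := norm_le_pi_norm v
    have hy : ∀ j : Fin m, ‖((z j.castSucc).im : ℂ)‖ ≤ 1 := fun j => by
      have h1 : ‖z - basePoint m‖ ≤ 1 := by
        have : ‖z - basePoint m‖ < ε := by simpa [dist_eq_norm] using hz
        exact this.le.trans ((min_le_left _ _).trans (min_le_right _ _))
      have h2 := (norm_le_pi_norm (z - basePoint m) j.castSucc).trans h1
      rw [Complex.norm_real]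
      simp only [Pi.sub_apply, basePoint_castSucc, sub_zero] at h2
      exact (Complex.abs_im_le_norm _).trans h2
    have hN : ‖normalForm z v‖ ≤ (1 + 2 * m) * ‖v‖ := by
      refine (norm_sub_le _ _).trans ?_
      have : ‖∑ j : Fin m, ((z j.castSucc).im : ℂ) * v j.castSucc‖ ≤ ∑ _j : Fin m, ‖v‖ := by
        refine norm_sum_le_of_le _ fun j _ => ?_
        rw [norm_mul]
        calc _ ≤ 1 * ‖v‖ := by gcongr; exacts [hy j, hvk _]
          _ = ‖v‖ := one_mul _
      rw [norm_mul, Complex.norm_two]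
      simp at this
      nlinarith [hvk (Fin.last m)]
    have hsum : ∑ j : Fin m, ‖v j.castSucc‖ ^ 2 ≤ m * ‖v‖ ^ 2 := by
      have : ∑ j : Fin m, ‖v j.castSucc‖ ^ 2 ≤ ∑ _j : Fin m, ‖v‖ ^ 2 :=
        Finset.sum_le_sum fun j _ => by gcongr; exact hvk _
      simpa using this
    have i1 : ‖normalForm z v‖ ^ 2 / (4 * rho z ^ 2) ≤ ((1 + 2 * m) * ‖v‖) ^ 2 := by
      rw [div_le_iff₀ (by positivity)]
      calc ‖normalForm z v‖ ^ 2 ≤ ((1 + 2 * m) * ‖v‖) ^ 2 * 1 := by rw [mul_one]; gcongr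
        _ ≤ _ := by gcongr; nlinarith
    have i2 : (∑ j : Fin m, ‖v j.castSucc‖ ^ 2) / (2 * rho z) ≤ m * ‖v‖ ^ 2 := by
      rw [div_le_iff₀ (by positivity)]
      calc _ ≤ m * ‖v‖ ^ 2 * 1 := by rw [mul_one]; exact hsum
        _ ≤ _ := by gcongr; linarith
    have : (0 : ℝ) ≤ m := by positivity
    calc _ ≤ ((1 + 2 * m) * ‖v‖) ^ 2 + m * ‖v‖ ^ 2 := add_le_add i1 i2
      _ = ((1 + 2 * m) ^ 2 + m) * ‖v‖ ^ 2 := by ring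
      _ ≤ C ^ 2 * ‖v‖ ^ 2 := by gcongr; rw [hC]; nlinarith
      _ = _ := by ring
  have hlen : bergmanLength (fun t : ℝ => basePoint m + t • (w - basePoint m)) ≤
      C * ‖w - basePoint m‖ := by
    have := intervalIntegral.integral_mono_on zero_le_one hcurve.intervalIntegrable_speed
      (intervalIntegrable_const (c := C * ‖w - basePoint m‖)) hbound
    simpa [bergmanLength] using this
  refine hlen.trans_lt ?_
  have : ‖w - basePoint m‖ < r / C := hv.trans_le (min_le_right _ _)
  rw [lt_div_iff₀ hC0] at this
  linarith

/-! ### The transitive group of affine automorphisms -/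

/-- The linear part of the affine automorphism `tubeAut a`. -/
def tubeLinMap (a : Cn m) : Cn m →ₗ[ℂ] Cn m where
  toFun z := Fin.snoc (α := fun _ => ℂ) (fun j : Fin m => (√(rho a) : ℂ) * z j.castSucc)
    (rho a * z (Fin.last m)
      + 2 * √(rho a) * ∑ j : Fin m, ((a j.castSucc).im : ℂ) * z j.castSucc)
  map_add' z w := by
    ext k
    refine Fin.lastCases ?_ (fun j => ?_) k
    · simp [mul_add, Finset.sum_add_distrib]; ring
    · simp [mul_add]
  map_smul' c z := by
    ext k
    refine Fin.lastCases ?_ (fun j => ?_) k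
    · simp only [Fin.snoc_last, Pi.smul_apply, smul_eq_mul, RingHom.id_apply, mul_add,
        Finset.mul_sum]
      congr 1
      · ring
      · exact Finset.sum_congr rfl fun j _ => by ring
    · simp; ring

@[simp] theorem tubeLinMap_castSucc (a z : Cn m) (j : Fin m) :
    tubeLinMap a z j.castSucc = (√(rho a) : ℂ) * z j.castSucc := by simp [tubeLinMap]

@[simp] theorem tubeLinMap_last (a z : Cn m) :
    tubeLinMap a z (Fin.last m) = rho a * z (Fin.last m)
      + 2 * √(rho a) * ∑ j : Fin m, ((a j.castSucc).im : ℂ) * z j.castSucc := by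
  simp [tubeLinMap]

/-- Only the last coordinate mixes the others, so the matrix is triangular. -/
theorem det_tubeLinMap {a : Cn m} :
    LinearMap.det (tubeLinMap a) = (√(rho a) : ℂ) ^ m * rho a := by
  rw [← LinearMap.det_toMatrix', Matrix.det_of_isLowerTriangular, Fin.prod_univ_castSucc]
  · simp [LinearMap.toMatrix'_apply]
  · intro i j hij
    rw [LinearMap.toMatrix'_apply]
    have hij : i < j := hij
    induction i using Fin.lastCases with
    | last => exact absurd hij (not_lt.2 (Fin.le_last j))
    | cast i => simp [hij.ne]

/-- The linear part of `tubeAut a` as an invertible map. -/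
def tubeLin (a : tubeDomain m) : Cn m ≃L[ℂ] Cn m :=
  (LinearEquiv.ofIsUnitDet (f := tubeLinMap (a : Cn m))
    (v := Pi.basisFun ℂ _) (v' := Pi.basisFun ℂ _) (by
      have h := rho_pos a
      rw [LinearMap.toMatrix_eq_toMatrix', LinearMap.det_toMatrix', det_tubeLinMap,
        isUnit_iff_ne_zero]
      have h1 : (√(rho (a : Cn m)) : ℂ) ≠ 0 := by exact_mod_cast (Real.sqrt_pos.2 h).ne'
      have h2 : (rho (a : Cn m) : ℂ) ≠ 0 := by exact_mod_cast h.ne'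
      exact mul_ne_zero (pow_ne_zero _ h1) h2)).toContinuousLinearEquiv

theorem tubeLin_apply (a : tubeDomain m) (z : Cn m) : tubeLin a z = tubeLinMap (a : Cn m) z := rfl

/-- The translation part of `tubeAut a`. -/
def tubeShift (a : Cn m) : Cn m :=
  Fin.snoc (α := fun _ => ℂ) (fun j : Fin m => a j.castSucc)
    ((a (Fin.last m)).re + Complex.I * ∑ j : Fin m, ((a j.castSucc).im : ℂ) ^ 2)

/-- The affine automorphism of the domain that takes the base point to `a`. -/
def tubeAut (a : tubeDomain m) (z : Cn m) : Cn m := tubeLin a z + tubeShift a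

/-- The inverse of `tubeAut a`. -/
def tubeAutInv (a : tubeDomain m) (w : Cn m) : Cn m := (tubeLin a).symm (w - tubeShift a)

section

variable (a : tubeDomain m) (z w v : Cn m)

@[simp] theorem tubeAut_tubeAutInv : tubeAut a (tubeAutInv a w) = w := by
  simp [tubeAut, tubeAutInv]

@[simp] theorem tubeAutInv_tubeAut : tubeAutInv a (tubeAut a z) = z := by
  simp [tubeAut, tubeAutInv]

theorem contDiff_tubeAut {n : WithTop ℕ∞} : ContDiff ℂ n (tubeAut a) :=
  (tubeLin a).contDiff.add contDiff_const

theorem contDiff_tubeAutInv {n : WithTop ℕ∞} : ContDiff ℂ n (tubeAutInv a) :=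
  (tubeLin a).symm.contDiff.comp (contDiff_id.sub contDiff_const)

theorem continuous_tubeAut : Continuous (tubeAut a) :=
  (contDiff_tubeAut a (n := 0)).continuous

theorem continuous_tubeAutInv : Continuous (tubeAutInv a) :=
  (contDiff_tubeAutInv a (n := 0)).continuous

@[simp] theorem tubeAut_castSucc (j : Fin m) : tubeAut a z j.castSucc =
    (√(rho (a : Cn m)) : ℂ) * z j.castSucc + (a : Cn m) j.castSucc := by
  simp [tubeAut, tubeLin_apply, tubeShift]

@[simp] theorem tubeAut_last : tubeAut a z (Fin.last m) = rho (a : Cn m) * z (Fin.last m)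
      + 2 * √(rho (a : Cn m)) * (∑ j : Fin m, (((a : Cn m) j.castSucc).im : ℂ) * z j.castSucc)
      + (((a : Cn m) (Fin.last m)).re
        + Complex.I * ∑ j : Fin m, (((a : Cn m) j.castSucc).im : ℂ) ^ 2) := by
  simp [tubeAut, tubeLin_apply, tubeShift]

@[simp] theorem tubeAut_basePoint : tubeAut a (basePoint m) = a := by
  ext k
  refine Fin.lastCases ?_ (fun j => ?_) k
  · rw [tubeAut_last]
    apply Complex.ext
    · simp [← Complex.ofReal_pow, ← Complex.ofReal_sum]
    · simp [← Complex.ofReal_pow, ← Complex.ofReal_sum, rho]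
  · simp

theorem sq_sqrt_rho : (√(rho (a : Cn m)) : ℂ) ^ 2 = rho (a : Cn m) := by
  exact_mod_cast Real.sq_sqrt (rho_pos a).le

/-- Translating the first `m` coordinates creates a linear cross term and a constant in the squares.
The shear and the imaginary translation of the last coordinate are chosen to cancel them. -/
theorem rho₂_tubeAut : rho₂ (tubeAut a z) (tubeAut a w) = rho (a : Cn m) * rho₂ z w := by
  simp only [rho₂, tubeAut_castSucc, tubeAut_last, map_add, map_mul, map_sum, map_pow,
    Complex.conj_ofReal, Complex.conj_I, map_ofNat]
  have h1 : ∀ j : Fin m, ((√(rho (a : Cn m)) : ℂ) * z j.castSucc + (a : Cn m) j.castSucc -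
      (√(rho (a : Cn m)) * starRingEnd ℂ (w j.castSucc)
        + starRingEnd ℂ ((a : Cn m) j.castSucc))) ^ 2 =
      rho (a : Cn m) * (z j.castSucc - starRingEnd ℂ (w j.castSucc)) ^ 2
      + 4 * Complex.I * √(rho (a : Cn m)) *
        ((((a : Cn m) j.castSucc).im : ℂ) * z j.castSucc
          - (((a : Cn m) j.castSucc).im : ℂ) * starRingEnd ℂ (w j.castSucc))
      - 4 * (((a : Cn m) j.castSucc).im : ℂ) ^ 2 := fun j => by
    have h2 : starRingEnd ℂ ((a : Cn m) j.castSucc) =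
        (a : Cn m) j.castSucc - 2 * Complex.I * (((a : Cn m) j.castSucc).im : ℂ) := by
      have := Complex.sub_conj ((a : Cn m) j.castSucc)
      push_cast at this
      linear_combination -this
    rw [h2, ← sq_sqrt_rho a]
    linear_combination 4 * (((a : Cn m) j.castSucc).im : ℂ) ^ 2 * Complex.I_sq
  simp only [h1, Finset.sum_sub_distrib, Finset.sum_add_distrib, ← Finset.mul_sum]
  linear_combination -(∑ j : Fin m, (((a : Cn m) j.castSucc).im : ℂ) ^ 2) * Complex.I_sq

theorem rho_tubeAut : rho (tubeAut a z) = rho (a : Cn m) * rho z := by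
  have := rho₂_tubeAut a z z
  rw [rho₂_self, rho₂_self] at this
  exact_mod_cast this

theorem rho₂_tubeAut_basePoint : rho₂ (tubeAut a z) a = rho (a : Cn m) * rho₂ z (basePoint m) := by
  simpa using rho₂_tubeAut a z (basePoint m)

variable {a z w v}

theorem tubeAut_mem : tubeAut a z ∈ tubeDomain m ↔ z ∈ tubeDomain m := by
  rw [mem_tubeDomain_iff, mem_tubeDomain_iff, rho_tubeAut, mul_pos_iff_of_pos_left (rho_pos a)]

theorem tubeAutInv_mem : tubeAutInv a w ∈ tubeDomain m ↔ w ∈ tubeDomain m := by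
  rw [← tubeAut_mem (a := a), tubeAut_tubeAutInv]

theorem normalForm_tubeAut :
    normalForm (tubeAut a z) (tubeLin a v) = rho (a : Cn m) * normalForm z v := by
  rw [tubeLin_apply, normalForm, normalForm]
  simp only [tubeLinMap_last, tubeLinMap_castSucc, tubeAut_castSucc, Complex.add_im,
    Complex.im_ofReal_mul, mul_sub, Finset.mul_sum]
  rw [add_sub_assoc, sub_eq_add_neg (_ * v (Fin.last m))]
  congr 1
  rw [← Finset.sum_sub_distrib, ← Finset.sum_neg_distrib]
  refine Finset.sum_congr rfl fun j _ => ?_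
  push_cast
  linear_combination (-2 * ((z j.castSucc).im : ℂ) * v j.castSucc) * sq_sqrt_rho a

/-- The normal form scales by `ρ(a)`, tangential components by `√ρ(a)` and `ρ` by `ρ(a)`, so each
term of the metric is unchanged. -/
theorem bergmanSpeed_tubeAut (hz : z ∈ tubeDomain m) :
    bergmanSpeed (tubeAut a z) (tubeLin a v) = bergmanSpeed z v := by
  have h1 := rho_pos a
  have h2 := mem_tubeDomain_iff.1 hz
  rw [bergmanSpeed_eq hz, bergmanSpeed_eq (tubeAut_mem.2 hz), normalForm_tubeAut, rho_tubeAut]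
  simp only [tubeLin_apply, tubeLinMap_castSucc, norm_mul, mul_pow, ← Finset.mul_sum,
    Complex.norm_real, Real.norm_of_nonneg h1.le, Real.norm_of_nonneg (Real.sqrt_nonneg _),
    Real.sq_sqrt h1.le]
  congr 2 <;> field_simp

theorem IsSmoothCurve.tubeAut {γ : ℝ → Cn m} (h : IsSmoothCurve γ z w) (a : tubeDomain m) :
    IsSmoothCurve (fun t => tubeAut a (γ t)) (tubeAut a z) (tubeAut a w) :=
  ⟨((contDiff_tubeAut a).restrict_scalars ℝ).comp_contDiffOn h.1,
    fun _ ht => tubeAut_mem.2 (h.2.1 ht), by simp [h.2.2.1], by simp [h.2.2.2]⟩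

theorem IsSmoothCurve.tubeAutInv {γ : ℝ → Cn m} (h : IsSmoothCurve γ z w) (a : tubeDomain m) :
    IsSmoothCurve (fun t => tubeAutInv a (γ t)) (tubeAutInv a z) (tubeAutInv a w) :=
  ⟨((contDiff_tubeAutInv a).restrict_scalars ℝ).comp_contDiffOn h.1,
    fun _ ht => tubeAutInv_mem.2 (h.2.1 ht), by simp [h.2.2.1], by simp [h.2.2.2]⟩

theorem IsSmoothCurve.bergmanLength_tubeAut {γ : ℝ → Cn m} (h : IsSmoothCurve γ z w) :
    bergmanLength (fun t => TubeBergman.tubeAut a (γ t)) = bergmanLength γ := by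
  refine intervalIntegral.integral_congr fun t ht => ?_
  rw [uIcc_of_le zero_le_one] at ht
  have h1 : HasDerivWithinAt (fun t => TubeBergman.tubeAut a (γ t))
      (tubeLin a (derivWithin γ (Icc 0 1) t)) (Icc 0 1) t :=
    ((((tubeLin a).hasFDerivAt (x := γ t)).restrictScalars ℝ).comp_hasDerivWithinAt t
      (h.hasDerivWithinAt ht)).add_const _
  rw [h1.derivWithin (uniqueDiffOn_Icc zero_lt_one t ht), bergmanSpeed_tubeAut (h.2.1 ht)]

theorem bergmanDist_tubeAut (a : tubeDomain m) (z w : Cn m) :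
    bergmanDist (tubeAut a z) (tubeAut a w) = bergmanDist z w := by
  rw [bergmanDist, bergmanDist]
  congr 1
  ext l
  constructor
  · rintro ⟨γ, h, rfl⟩
    have h1 := h.tubeAutInv a
    rw [tubeAutInv_tubeAut, tubeAutInv_tubeAut] at h1
    refine ⟨_, h1, ?_⟩
    rw [← h1.bergmanLength_tubeAut (a := a)]
    simp
  · rintro ⟨γ, h, rfl⟩
    exact ⟨_, h.tubeAut a, h.bergmanLength_tubeAut⟩

theorem bergmanDist_eq_tubeAutInv (a : tubeDomain m) (w : Cn m) :
    bergmanDist a w = bergmanDist (basePoint m) (tubeAutInv a w) := by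
  rw [← bergmanDist_tubeAut a (basePoint m), tubeAut_basePoint, tubeAut_tubeAutInv]

/-- Under `tubeAut a` Lebesgue measure is multiplied by `ρ(a) ^ (n + 1)`. -/
theorem lintegral_tubeAut (a : tubeDomain m) (f : Cn m → ℝ≥0∞) :
    ∫⁻ z, f z = ENNReal.ofReal (rho (a : Cn m) ^ (m + 2)) * ∫⁻ z, f (tubeAut a z) := by
  have h := rho_pos a
  -- The real Jacobian is the squared modulus of the complex determinant.
  have hdet : LinearMap.det ((tubeLinMap (a : Cn m)).restrictScalars ℝ) =
      rho (a : Cn m) ^ (m + 2) := by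
    rw [LinearMap.det_restrictScalars, det_tubeLinMap, Algebra.norm_complex_apply, map_mul, map_pow,
      Complex.normSq_ofReal, Complex.normSq_ofReal, Real.mul_self_sqrt h.le]
    ring
  have hmap := Measure.map_linearMap_addHaar_eq_smul_addHaar
    (volume : Measure (Cn m)) (f := (tubeLinMap (a : Cn m)).restrictScalars ℝ)
    (by rw [hdet]; positivity)
  have hemb : MeasurableEmbedding ((tubeLinMap (a : Cn m)).restrictScalars ℝ) :=
    (tubeLin a).toHomeomorph.measurableEmbedding
  have h1 : ∫⁻ z, f (tubeAut a z) =
      ∫⁻ w, f (w + tubeShift a) ∂(Measure.map ((tubeLinMap (a : Cn m)).restrictScalars ℝ) volume) :=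
    (hemb.lintegral_map (μ := volume) fun w => f (w + tubeShift a)).symm
  rw [h1, hmap, lintegral_smul_measure, lintegral_add_right_eq_self f, hdet, smul_eq_mul,
    ← mul_assoc, ← ENNReal.ofReal_mul (by positivity), abs_of_pos (by positivity),
    mul_inv_cancel₀ (by positivity)]
  simp

end

/-! ### Bergman balls and lattices -/

theorem mem_bergmanBall {a w : tubeDomain m} {r : ℝ} :
    w ∈ bergmanBall a r ↔ bergmanDist (a : Cn m) w < r := Iff.rfl

theorem mem_bergmanBall_comm {a w : tubeDomain m} {r : ℝ} :
    w ∈ bergmanBall a r ↔ a ∈ bergmanBall w r := by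
  rw [mem_bergmanBall, mem_bergmanBall, bergmanDist_comm a.2 w.2]

theorem mem_bergmanBall_add {a w u : tubeDomain m} {r s : ℝ} (hw : w ∈ bergmanBall a r)
    (hu : u ∈ bergmanBall w s) : u ∈ bergmanBall a (r + s) :=
  (bergmanDist_triangle a.2 w.2 u.2).trans_lt (add_lt_add hw hu)

theorem mem_bergmanBall_self {a : tubeDomain m} {r : ℝ} (hr : 0 < r) : a ∈ bergmanBall a r := by
  rwa [mem_bergmanBall, bergmanDist_self a.2]

theorem bergmanBall_mono (a : tubeDomain m) {r s : ℝ} (h : r ≤ s) :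
    bergmanBall a r ⊆ bergmanBall a s := fun _ hw => lt_of_lt_of_le hw h

theorem bergmanBall_mem_nhds (a : tubeDomain m) {r : ℝ} (hr : 0 < r) : bergmanBall a r ∈ 𝓝 a := by
  obtain ⟨ε, hε, h⟩ := exists_ball_subset_bergmanDist_lt m hr
  have hc : Continuous fun w : tubeDomain m => tubeAutInv a (w : Cn m) :=
    (continuous_tubeAutInv a).comp continuous_subtype_val
  have h1 : tubeAutInv a (a : Cn m) = basePoint m := by
    conv_lhs => rw [← tubeAut_basePoint a]
    rw [tubeAutInv_tubeAut]
  filter_upwards [hc.continuousAt.preimage_mem_nhds (x := a)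
    (by rw [h1]; exact Metric.ball_mem_nhds _ hε)] with w hw
  rw [mem_bergmanBall, bergmanDist_eq_tubeAutInv]
  exact (h _ hw).2.1

theorem isOpen_bergmanBall (a : tubeDomain m) (r : ℝ) : IsOpen (bergmanBall a r) := by
  refine isOpen_iff_mem_nhds.2 fun w hw => ?_
  have h : 0 < r - bergmanDist (a : Cn m) w := sub_pos.2 hw
  filter_upwards [bergmanBall_mem_nhds w h] with u hu
  have h1 := bergmanDist_triangle a.2 w.2 u.2
  rw [mem_bergmanBall] at *
  linarith

theorem isCompact_preimage_val {K : Set (Cn m)} (hK : IsCompact K) (hT : K ⊆ tubeDomain m) :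
    IsCompact ((↑) ⁻¹' K : Set (tubeDomain m)) := by
  rw [Subtype.isCompact_iff, Subtype.image_preimage_coe, inter_eq_right.2 hT]
  exact hK

theorem exists_isCompact_bergmanBall_subset (a : tubeDomain m) (r : ℝ) :
    ∃ K : Set (tubeDomain m), IsCompact K ∧ bergmanBall a r ⊆ K := by
  obtain ⟨K, hT, hK, h⟩ := exists_isCompact_of_bergmanDist_lt m r
  refine ⟨_, isCompact_preimage_val (hK.image (continuous_tubeAut a)) ?_, fun w hw => ?_⟩
  · rintro _ ⟨w, hw, rfl⟩
    exact tubeAut_mem.2 (hT hw)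
  · rw [mem_bergmanBall, bergmanDist_eq_tubeAutInv] at hw
    exact ⟨_, h _ (tubeAutInv_mem.2 w.2) hw, tubeAut_tubeAutInv a w⟩

/-- Large Bergman balls are covered by a uniformly bounded number of small ones. -/
theorem exists_card_cover_bergmanBall (m : ℕ) {s : ℝ} (hs : 0 < s) (R : ℝ) :
    ∃ N : ℕ, ∀ z : tubeDomain m, ∃ t : Finset (tubeDomain m), t.card ≤ N ∧
      bergmanBall z R ⊆ ⋃ b ∈ t, bergmanBall b s := by
  classical
  obtain ⟨K, hT, hK, h⟩ := exists_isCompact_of_bergmanDist_lt m R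
  obtain ⟨t, -, ht⟩ := (isCompact_preimage_val hK hT).elim_nhds_subcover
    (fun b => bergmanBall b s) fun b _ => bergmanBall_mem_nhds b hs
  refine ⟨t.card, fun z => ⟨t.image fun b : tubeDomain m => ⟨tubeAut z b, tubeAut_mem.2 b.2⟩,
    Finset.card_image_le, fun w hw => ?_⟩⟩
  rw [mem_bergmanBall, bergmanDist_eq_tubeAutInv] at hw
  have h1 := ht (show (⟨tubeAutInv z w, tubeAutInv_mem.2 w.2⟩ : tubeDomain m) ∈ _ from
    h _ (tubeAutInv_mem.2 w.2) hw)
  obtain ⟨b, hb, hbw⟩ := mem_iUnion₂.1 h1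
  refine mem_iUnion₂.2 ⟨_, Finset.mem_image_of_mem _ hb, ?_⟩
  rw [mem_bergmanBall] at hbw ⊢
  rw [← tubeAut_tubeAutInv z (w : Cn m), bergmanDist_tubeAut]
  exact hbw

theorem subsingleton_of_pairwise_disjoint {ι : Type*} {s : ℝ} {a : ι → tubeDomain m}
    (h : Pairwise fun k l => Disjoint (bergmanBall (a k) s) (bergmanBall (a l) s))
    (z : tubeDomain m) : {k | a k ∈ bergmanBall z s}.Subsingleton := by
  intro k hk l hl
  by_contra hne
  exact disjoint_left.1 (h hne) (mem_bergmanBall_comm.1 hk) (mem_bergmanBall_comm.1 hl)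

/-- The centres concerned lie in `D(z, R)`, which `N` balls of radius `s` cover; disjointness allows
at most one centre in each of these. -/
theorem exists_overlap_bound {ι : Type*} {s : ℝ} (hs : 0 < s) (R : ℝ) {a : ι → tubeDomain m}
    (h : Pairwise fun k l => Disjoint (bergmanBall (a k) s) (bergmanBall (a l) s)) :
    ∃ N : ℕ, ∀ z, {k | z ∈ bergmanBall (a k) R}.encard ≤ N := by
  obtain ⟨N, hN⟩ := exists_card_cover_bergmanBall m hs R
  refine ⟨N, fun z => ?_⟩
  obtain ⟨t, ht, hc⟩ := hN z
  have h1 : ∀ k ∈ {k | z ∈ bergmanBall (a k) R}, ∃ b ∈ t, a k ∈ bergmanBall b s := fun k hk => by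
    simpa using hc (mem_bergmanBall_comm.1 hk)
  have : Nonempty (tubeDomain m) := ⟨z⟩
  choose! f hf hfb using h1
  calc {k | z ∈ bergmanBall (a k) R}.encard ≤ (t : Set (tubeDomain m)).encard :=
        Set.encard_le_encard_of_injOn (f := f) (fun k hk => hf k hk) fun k hk l hl hkl =>
          subsingleton_of_pairwise_disjoint h (f k) (hfb k hk)
            (by rw [hkl]; exact hfb l hl)
    _ = t.card := Set.encard_coe_eq_coe_finsetCard t
    _ ≤ N := by exact_mod_cast ht

theorem IsBergmanLattice.tendsto_cocompact {r : ℝ} (hr : 0 < r) {a : ℕ → tubeDomain m}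
    (h : IsBergmanLattice r a) : Tendsto a atTop (cocompact (tubeDomain m)) := by
  rw [← Nat.cofinite_eq_atTop]
  refine (hasBasis_cocompact.tendsto_right_iff).2 fun K hK => ?_
  obtain ⟨t, -, ht⟩ := hK.elim_nhds_subcover (fun b => bergmanBall b (r / 4))
    fun b _ => bergmanBall_mem_nhds b (by positivity)
  have hfin : (⋃ b ∈ t, {k | a k ∈ bergmanBall b (r / 4)}).Finite :=
    t.finite_toSet.biUnion fun b _ => (subsingleton_of_pairwise_disjoint h.disjoint b).finite
  refine hfin.subset fun k hk => ?_
  have hk : a k ∈ K := by simpa using hk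
  simpa using ht hk

/-- A bounded set on which `ρ` is at least `ε > 0` lies in a compact subset of the domain. -/
theorem cocompact_le_boundaryFilter (m : ℕ) : cocompact (tubeDomain m) ≤ boundaryFilter m := by
  intro U hU
  obtain ⟨h1, h2⟩ := mem_sup.1 hU
  obtain ⟨V, hV, hVU⟩ := mem_comap.1 h1
  obtain ⟨W, hW, hWU⟩ := mem_comap.1 h2
  obtain ⟨ε, hε, hεV⟩ := Metric.mem_nhds_iff.1 hV
  obtain ⟨R, hR⟩ := mem_atTop_sets.1 hW
  refine mem_cocompact.2 ⟨(↑) ⁻¹' ({z : Cn m | ε ≤ rho z} ∩ Metric.closedBall 0 R),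
    isCompact_preimage_val
      ((isCompact_closedBall _ _).inter_left (isClosed_le continuous_const continuous_rho))
      fun z hz => mem_tubeDomain_iff.2 (hε.trans_le hz.1), fun z hz => ?_⟩
  by_cases hzε : ε ≤ rho (z : Cn m)
  · have hzR : R < ‖(z : Cn m)‖ := by
      by_contra hzR
      exact hz ⟨hzε, mem_closedBall_zero_iff.2 (not_lt.1 hzR)⟩
    refine hWU (hR _ (hzR.le.trans ?_))
    refine (pi_norm_le_iff_of_nonneg (Real.sqrt_nonneg _)).2 fun i => Real.le_sqrt_of_sq_le ?_
    exact Finset.single_le_sum (f := fun i => ‖(z : Cn m) i‖ ^ 2)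
      (fun _ _ => by positivity) (Finset.mem_univ i)
  · refine hVU (hεV ?_)
    rw [Metric.mem_ball, Real.dist_eq, sub_zero, abs_of_pos (rho_pos z)]
    exact not_le.1 hzε

theorem not_isCompact_univ_tubeDomain : ¬ IsCompact (univ : Set (tubeDomain m)) := by
  intro h
  obtain ⟨C, hC⟩ := h.exists_bound_of_continuousOn (f := fun z : tubeDomain m => rho (z : Cn m))
    (continuous_rho.comp continuous_subtype_val).continuousOn
  have h1 : rho (((|C| + 1 : ℝ) : ℂ) • basePoint m) = |C| + 1 := by
    simp [rho]
  have := hC ⟨((|C| + 1 : ℝ) : ℂ) • basePoint m, mem_tubeDomain_iff.2 (by rw [h1]; positivity)⟩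
    (mem_univ _)
  simp only [h1] at this
  rw [Real.norm_of_nonneg (by positivity)] at this
  linarith [le_abs_self C]

/-- The centres form a maximal family with disjoint balls of radius `r / 4`. A point at distance at
least `r` from all of them could be added, so the balls of radius `r` cover. -/
theorem exists_isBergmanLattice (m : ℕ) {r : ℝ} (hr : 0 < r) :
    ∃ a : ℕ → tubeDomain m, IsBergmanLattice r a := by
  obtain ⟨S, hS⟩ := zorn_subset
    {S : Set (tubeDomain m) | S.PairwiseDisjoint fun a => bergmanBall a (r / 4)}
    fun c hc hchain => ⟨⋃₀ c, (pairwiseDisjoint_sUnion hchain.directedOn).2 fun s hs => hc hs,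
      fun s hs => subset_sUnion_of_mem hs⟩
  have hdisj : S.PairwiseDisjoint fun a => bergmanBall a (r / 4) := hS.prop
  have hr4 : 0 < r / 4 := by positivity
  have hcover : ∀ z, ∃ a ∈ S, z ∈ bergmanBall a r := by
    intro z
    by_contra! hz
    have hdz : ∀ a ∈ S, Disjoint (bergmanBall z (r / 4)) (bergmanBall a (r / 4)) := fun a ha => by
      refine disjoint_left.2 fun w hw hwa => hz a ha ?_
      have := mem_bergmanBall_add hwa (mem_bergmanBall_comm.1 hw)
      exact bergmanBall_mono a (by linarith) this
    have hins : insert z S ∈ {S : Set (tubeDomain m) |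
        S.PairwiseDisjoint fun a => bergmanBall a (r / 4)} :=
      hdisj.insert fun a ha _ => hdz a ha
    exact hz z (hS.le_of_ge hins (subset_insert z S) (mem_insert z S)) (mem_bergmanBall_self hr)
  have hcount : S.Countable := hdisj.countable_of_isOpen (fun a _ => isOpen_bergmanBall a _)
    fun a _ => ⟨a, mem_bergmanBall_self hr4⟩
  -- A lattice is indexed by `ℕ` without repetition, so a finite family must be excluded: finitely
  -- many relatively compact balls cannot cover the noncompact domain.
  have hinf : S.Infinite := by
    intro hfin
    choose K hK hbK using fun a : tubeDomain m => exists_isCompact_bergmanBall_subset a r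
    refine not_isCompact_univ_tubeDomain (m := m) ?_
    convert hfin.isCompact_biUnion (f := K) fun a _ => hK a
    refine (eq_univ_of_forall fun z => ?_).symm
    obtain ⟨a, ha, hz⟩ := hcover z
    exact mem_biUnion ha (hbK a hz)
  have : Countable S := hcount.to_subtype
  have : Infinite S := hinf.to_subtype
  obtain ⟨_⟩ := nonempty_denumerable S
  set e : ℕ ≃ S := (Denumerable.eqv S).symm
  have hpair : Pairwise fun k l => Disjoint (bergmanBall (e k : tubeDomain m) (r / 4))
      (bergmanBall (e l : tubeDomain m) (r / 4)) := fun k l hkl =>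
    hdisj (e k).2 (e l).2 fun h => hkl (e.injective (Subtype.ext h))
  refine ⟨fun k => e k, eq_univ_of_forall fun z => ?_, hpair, exists_overlap_bound hr4 _ hpair⟩
  obtain ⟨a, ha, hz⟩ := hcover z
  exact mem_iUnion.2 ⟨e.symm ⟨a, ha⟩, by simpa using hz⟩

/-! ### The sub-mean value property -/

/-- The uniform probability measure on the interval `(0, 2π]`. -/
def angleMeasure : Measure ℝ :=
  (ENNReal.ofReal (2 * Real.pi))⁻¹ • volume.restrict (Ioc 0 (2 * Real.pi))

instance : IsProbabilityMeasure angleMeasure := by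
  refine ⟨?_⟩
  rw [angleMeasure, Measure.smul_apply, Measure.restrict_apply_univ, Real.volume_Ioc, sub_zero,
    smul_eq_mul]
  exact ENNReal.inv_mul_cancel (by simpa using Real.pi_pos) ENNReal.ofReal_ne_top

theorem circleAverage_eq_integral (g : ℂ → ℂ) (c : ℂ) (R : ℝ) :
    Real.circleAverage g c R = ∫ θ, g (circleMap c R θ) ∂angleMeasure := by
  rw [Real.circleAverage, angleMeasure, integral_smul_measure,
    intervalIntegral.integral_of_le (by positivity), ENNReal.toReal_inv,
    ENNReal.toReal_ofReal (by positivity)]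

/-- The `p`-th power of the modulus of a holomorphic function at the centre of the unit disc is at
most its mean over the circle. -/
theorem enorm_rpow_le_lintegral_circle {g : ℂ → ℂ} {p : ℝ} (hp : 1 ≤ p)
    (hg : DiffContOnCl ℂ g (Metric.ball 0 1)) :
    ‖g 0‖ₑ ^ p ≤ ∫⁻ θ, ‖g (circleMap 0 1 θ)‖ₑ ^ p ∂angleMeasure := by
  have hp0 : 0 < p := by linarith
  have hmean : g 0 = ∫ θ, g (circleMap 0 1 θ) ∂angleMeasure := by
    rw [← circleAverage_eq_integral]
    exact (DiffContOnCl.circleAverage (by simpa using hg)).symm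
  have hcont : Continuous fun θ => g (circleMap 0 1 θ) := by
    refine hg.continuousOn.comp_continuous (continuous_circleMap 0 1) fun θ => ?_
    rw [closure_ball _ one_ne_zero]
    exact circleMap_mem_closedBall 0 zero_le_one θ
  have h1 : ‖g 0‖ₑ ≤ ∫⁻ θ, ‖g (circleMap 0 1 θ)‖ₑ ∂angleMeasure := by
    rw [hmean]; exact enorm_integral_le_lintegral_enorm _
  -- On a probability space the `L^1` norm is at most the `L^p` norm.
  have h2 := eLpNorm'_le_eLpNorm'_of_exponent_le zero_lt_one hp angleMeasure
    hcont.aestronglyMeasurable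
  simp only [eLpNorm', ENNReal.rpow_one, div_one] at h2
  calc ‖g 0‖ₑ ^ p ≤ ((∫⁻ θ, ‖g (circleMap 0 1 θ)‖ₑ ^ p ∂angleMeasure) ^ (1 / p)) ^ p := by
        gcongr; exact h1.trans h2
    _ = _ := by rw [← ENNReal.rpow_mul, one_div_mul_cancel hp0.ne', ENNReal.rpow_one]

theorem lintegral_circleMap_smul (G : Cn m → ℝ≥0∞) (hG : Measurable G) (θ : ℝ) :
    ∫⁻ ζ, G (circleMap 0 1 θ • ζ) = ∫⁻ ζ, G ζ := by
  have h : MeasurePreserving (fun ζ : Cn m => circleMap 0 1 θ • ζ) volume volume := by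
    have h1 := volume_preserving_pi (ι := Fin (m + 1)) (α' := fun _ => ℂ) (β' := fun _ => ℂ)
      (f := fun _ => rotation (Circle.exp θ))
      fun _ => (rotation (Circle.exp θ)).measurePreserving
    have e : (fun ζ : Cn m => circleMap 0 1 θ • ζ) =
        fun ζ i => rotation (Circle.exp θ) (ζ i) := by
      ext ζ i
      simp [circleMap]
    rw [e]
    exact h1
  exact h.lintegral_comp hG

/-- Each `ζ` gives a disc `u ↦ c + u ζ` through the centre, where the one-variable inequality
applies. Integrating over `ζ`, Fubini and rotation invariance of Lebesgue measure remove the circle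
average. -/
theorem enorm_rpow_mul_volume_ball_le {f : Cn m → ℂ} {c : Cn m} {ε p : ℝ} (hp : 1 ≤ p)
    (hf : DifferentiableOn ℂ f (Metric.ball c ε)) :
    ‖f c‖ₑ ^ p * volume (Metric.ball c ε) ≤ ∫⁻ w in Metric.ball c ε, ‖f w‖ₑ ^ p := by
  classical
  set F : Cn m → ℝ≥0∞ := (Metric.ball c ε).indicator fun w => ‖f w‖ₑ ^ p with hF
  have hFm : Measurable F := by
    rw [hF, ← piecewise_eq_indicator]
    exact ContinuousOn.measurable_piecewise
      (ENNReal.continuous_rpow_const.comp_continuousOn hf.continuousOn.enorm)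
      continuousOn_const Metric.isOpen_ball.measurableSet
  have hpt : ∀ ζ ∈ Metric.ball (0 : Cn m) ε,
      ‖f c‖ₑ ^ p ≤ ∫⁻ θ, F (c + circleMap 0 1 θ • ζ) ∂angleMeasure := fun ζ hζ => by
    have hmem : ∀ u ∈ Metric.closedBall (0 : ℂ) 1, c + u • ζ ∈ Metric.ball c ε := fun u hu => by
      rw [mem_closedBall_zero_iff] at hu
      rw [mem_ball_zero_iff] at hζ
      rw [Metric.mem_ball, dist_eq_norm, add_sub_cancel_left, norm_smul]
      nlinarith [norm_nonneg ζ]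
    have hd : DifferentiableOn ℂ (fun u : ℂ => f (c + u • ζ)) (Metric.closedBall 0 1) :=
      hf.comp (by fun_prop) hmem
    have h1 := enorm_rpow_le_lintegral_circle hp (g := fun u : ℂ => f (c + u • ζ))
      (DifferentiableOn.diffContOnCl (by rwa [closure_ball _ one_ne_zero]))
    simp only [zero_smul, add_zero] at h1
    refine h1.trans (le_of_eq (lintegral_congr fun θ => ?_))
    rw [hF, indicator_of_mem (hmem _ (circleMap_mem_closedBall 0 zero_le_one θ))]
  have hvol : volume (Metric.ball c ε) = volume (Metric.ball (0 : Cn m) ε) :=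
    (Measure.addHaar_ball_center volume c ε)
  have hjoint : Measurable fun q : Cn m × ℝ => F (c + circleMap 0 1 q.2 • q.1) := by
    refine hFm.comp ((Continuous.measurable ?_))
    exact continuous_const.add
      (((continuous_circleMap 0 1).comp continuous_snd).smul continuous_fst)
  calc ‖f c‖ₑ ^ p * volume (Metric.ball c ε)
      = ∫⁻ ζ in Metric.ball (0 : Cn m) ε, ‖f c‖ₑ ^ p := by rw [setLIntegral_const, hvol]
    _ ≤ ∫⁻ ζ in Metric.ball (0 : Cn m) ε, ∫⁻ θ, F (c + circleMap 0 1 θ • ζ) ∂angleMeasure :=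
        setLIntegral_mono' measurableSet_ball hpt
    _ ≤ ∫⁻ ζ, ∫⁻ θ, F (c + circleMap 0 1 θ • ζ) ∂angleMeasure := setLIntegral_le_lintegral _ _
    _ = ∫⁻ θ, (∫⁻ ζ, F (c + circleMap 0 1 θ • ζ)) ∂angleMeasure :=
        lintegral_lintegral_swap hjoint.aemeasurable
    _ = ∫⁻ _θ, (∫⁻ w, F w) ∂angleMeasure := by
        refine lintegral_congr fun θ => ?_
        rw [lintegral_circleMap_smul (fun ζ => F (c + ζ)) (by fun_prop) θ,
          lintegral_add_left_eq_self F c]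
    _ = ∫⁻ w in Metric.ball c ε, ‖f w‖ₑ ^ p := by
        rw [lintegral_const, measure_univ, mul_one, hF, lintegral_indicator measurableSet_ball]

theorem exists_pos_le_rpow (α : ℝ) : ∃ c > 0, ∀ x ∈ Icc (1 / 2 : ℝ) 2, c ≤ x ^ α := by
  refine ⟨min ((1 / 2 : ℝ) ^ α) (2 ^ α), by positivity, fun x hx => ?_⟩
  have hx0 : 0 < x := lt_of_lt_of_le (by norm_num) hx.1
  rcases le_total 0 α with h | h
  · exact (min_le_left _ _).trans (Real.rpow_le_rpow (by norm_num) hx.1 h)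
  · exact (min_le_right _ _).trans (Real.rpow_le_rpow_of_nonpos hx0 hx.2 h)

theorem measurableSet_image_bergmanBall (a : tubeDomain m) (r : ℝ) :
    MeasurableSet ((↑) '' bergmanBall a r : Set (Cn m)) :=
  (isOpen_tubeDomain.isOpenMap_subtype_val _ (isOpen_bergmanBall a r)).measurableSet

/-- The sub-mean value property over Bergman balls. -/
theorem exists_enorm_rpow_le_lintegral_bergmanBall (m : ℕ) {p r : ℝ} (hp : 1 ≤ p) (hr : 0 < r)
    (α : ℝ) : ∃ C : ℝ≥0∞, C ≠ ⊤ ∧ ∀ a : tubeDomain m, ∀ f : Cn m → ℂ,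
      DifferentiableOn ℂ f (tubeDomain m) →
      ‖f a‖ₑ ^ p * ENNReal.ofReal (rho (a : Cn m) ^ (((m + 1 : ℕ) : ℝ) + α + 1)) ≤
        C * ∫⁻ w in (↑) '' bergmanBall a r, ‖f w‖ₑ ^ p * ENNReal.ofReal (rho w ^ α) := by
  obtain ⟨ε, hε, hball⟩ := exists_ball_subset_bergmanDist_lt m hr
  obtain ⟨c, hc, hcα⟩ := exists_pos_le_rpow α
  set B := Metric.ball (basePoint m) ε
  have hV0 : volume B ≠ 0 := (Metric.measure_ball_pos _ _ hε).ne'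
  have hVt : volume B ≠ ⊤ := measure_ball_lt_top.ne
  have hc0 : ENNReal.ofReal c ≠ 0 := by simpa using hc
  refine ⟨(volume B * ENNReal.ofReal c)⁻¹,
    ENNReal.inv_ne_top.2 (mul_ne_zero hV0 hc0), fun a f hf => ?_⟩
  have ha := rho_pos a
  have hd : DifferentiableOn ℂ (fun w => f (tubeAut a w)) B :=
    hf.comp ((contDiff_tubeAut a (n := 1)).differentiable (by simp)).differentiableOn
      fun w hw => tubeAut_mem.2 (hball w hw).1
  have h1 := enorm_rpow_mul_volume_ball_le hp hd
  rw [tubeAut_basePoint] at h1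
  set D : Set (Cn m) := (↑) '' bergmanBall a r
  have hmemD : ∀ w ∈ B, tubeAut a w ∈ D := fun w hw =>
    ⟨⟨tubeAut a w, tubeAut_mem.2 (hball w hw).1⟩, by
      rw [mem_bergmanBall, bergmanDist_eq_tubeAutInv]
      simpa using (hball w hw).2.1, rfl⟩
  have h2 : ENNReal.ofReal (rho (a : Cn m) ^ (m + 2)) *
      (ENNReal.ofReal (rho (a : Cn m) ^ α) * (ENNReal.ofReal c *
        ∫⁻ w in B, ‖f (tubeAut a w)‖ₑ ^ p)) ≤
      ∫⁻ w in D, ‖f w‖ₑ ^ p * ENNReal.ofReal (rho w ^ α) := by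
    rw [← lintegral_indicator (measurableSet_image_bergmanBall a r), lintegral_tubeAut a,
      ← lintegral_const_mul' _ _ ENNReal.ofReal_ne_top,
      ← lintegral_const_mul' _ _ ENNReal.ofReal_ne_top,
      ← lintegral_indicator measurableSet_ball]
    gcongr with w
    by_cases hw : w ∈ B
    · rw [indicator_of_mem hw, indicator_of_mem (hmemD w hw), rho_tubeAut,
        Real.mul_rpow ha.le (mem_tubeDomain_iff.1 (hball w hw).1).le,
        ENNReal.ofReal_mul (by positivity)]
      calc ENNReal.ofReal (rho (a : Cn m) ^ α) * (ENNReal.ofReal c * ‖f (tubeAut a w)‖ₑ ^ p)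
          ≤ ENNReal.ofReal (rho (a : Cn m) ^ α) *
            (ENNReal.ofReal (rho w ^ α) * ‖f (tubeAut a w)‖ₑ ^ p) := by
              gcongr; exact hcα _ (hball w hw).2.2
        _ = _ := by ring
    · rw [indicator_of_notMem hw]; exact zero_le
  -- The exponent splits into `n + 1` from the Jacobian and `α` from the weight.
  have h3 : ENNReal.ofReal (rho (a : Cn m) ^ (((m + 1 : ℕ) : ℝ) + α + 1)) =
      ENNReal.ofReal (rho (a : Cn m) ^ (m + 2)) * ENNReal.ofReal (rho (a : Cn m) ^ α) := by
    rw [← ENNReal.ofReal_mul (by positivity), ← Real.rpow_natCast, ← Real.rpow_add ha]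
    congr 2; push_cast; ring
  rw [mul_comm _⁻¹, ← div_eq_mul_inv, ENNReal.le_div_iff_mul_le
    (Or.inl (mul_ne_zero hV0 hc0)) (Or.inl (ENNReal.mul_ne_top hVt ENNReal.ofReal_ne_top)), h3]
  calc _ = ENNReal.ofReal (rho (a : Cn m) ^ (m + 2)) * (ENNReal.ofReal (rho (a : Cn m) ^ α) *
        (ENNReal.ofReal c * (‖f a‖ₑ ^ p * volume B))) := by ring
    _ ≤ _ := by gcongr
    _ ≤ _ := h2

/-! ### The Forelli–Rudin integral -/

/-- Source of the positivity and of the main lower bounds for `|ρ₂|`: it dominates `ρ(z)`, `ρ(w)`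
and `|z' - w'|²` up to constants. -/
theorem re_rho₂ (z w : Cn m) : (rho₂ z w).re =
    (∑ j : Fin m, ‖z j.castSucc - w j.castSucc‖ ^ 2) / 4 + (rho z + rho w) / 2 := by
  have h (u v : ℂ) : ((u - starRingEnd ℂ v) ^ 2).re =
      ‖u - v‖ ^ 2 - 2 * u.im ^ 2 - 2 * v.im ^ 2 := by
    rw [Complex.sq_norm, Complex.normSq_apply, pow_two]
    simp
    ring
  have h4 : (1 / 4 : ℂ) = ((1 / 4 : ℝ) : ℂ) := by push_cast; rfl
  rw [rho₂, h4, Complex.re_ofReal_mul, Complex.sub_re, Complex.re_sum]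
  simp only [h, Finset.sum_sub_distrib, ← Finset.mul_sum, rho]
  simp
  ring

theorem rho₂_re_pos {z w : Cn m} (hz : z ∈ tubeDomain m) (hw : w ∈ tubeDomain m) :
    0 < (rho₂ z w).re := by
  rw [re_rho₂]
  have h1 := mem_tubeDomain_iff.1 hz
  have h2 := mem_tubeDomain_iff.1 hw
  positivity

theorem norm_rho₂_pos {z w : Cn m} (hz : z ∈ tubeDomain m) (hw : w ∈ tubeDomain m) :
    0 < ‖rho₂ z w‖ :=
  (rho₂_re_pos hz hw).trans_le (Complex.re_le_norm _)

theorem continuous_rho₂_left (w : Cn m) : Continuous fun z => rho₂ z w := by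
  unfold rho₂; fun_prop

/-- The shift of the last coordinate that flattens the domain onto a half space. -/
def flattenShift (x : Fin m → ℂ) : ℂ :=
  ((∑ j, (x j).re * (x j).im : ℝ) : ℂ) + ((∑ j, (x j).im ^ 2 : ℝ) : ℂ) * Complex.I

theorem im_sub_flattenShift (w : Cn m) :
    (w (Fin.last m) - flattenShift fun j => w j.castSucc).im = rho w := by
  simp only [flattenShift, rho, Complex.sub_im, Complex.add_im, Complex.ofReal_im,
    Complex.im_ofReal_mul, Complex.I_im]
  ring

theorem im_rho₂_basePoint (w : Cn m) : (rho₂ w (basePoint m)).im =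
    -(w (Fin.last m) - flattenShift fun j => w j.castSucc).re / 2 := by
  have h4 : (1 / 4 : ℂ) = ((1 / 4 : ℝ) : ℂ) := by push_cast; rfl
  have h (u : ℂ) : (u ^ 2).im = 2 * (u.re * u.im) := by rw [pow_two]; simp; ring
  rw [rho₂, h4, Complex.im_ofReal_mul, Complex.sub_im, Complex.im_sum]
  simp only [basePoint_castSucc, map_zero, sub_zero, h, ← Finset.mul_sum, flattenShift,
    Complex.sub_re, Complex.add_re, Complex.ofReal_re, Complex.re_ofReal_mul, Complex.I_re]
  simp
  ring

theorem le_four_mul_norm_rho₂ {w : Cn m} (hw : w ∈ tubeDomain m) :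
    1 + rho w ≤ 4 * ‖rho₂ w (basePoint m)‖ ∧
    1 + |(w (Fin.last m) - flattenShift fun j => w j.castSucc).re| ≤
      4 * ‖rho₂ w (basePoint m)‖ ∧
    ∀ j : Fin m, 1 + ‖w j.castSucc‖ ^ 2 ≤ 4 * ‖rho₂ w (basePoint m)‖ := by
  have h1 := (le_abs_self _).trans (Complex.abs_re_le_norm (rho₂ w (basePoint m)))
  have h2 := Complex.abs_im_le_norm (rho₂ w (basePoint m))
  rw [im_rho₂_basePoint, abs_div, abs_neg, abs_two] at h2
  rw [re_rho₂, rho_basePoint] at h1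
  simp only [basePoint_castSucc, sub_zero] at h1
  have hp := mem_tubeDomain_iff.1 hw
  have hs : ∀ j : Fin m, ‖w j.castSucc‖ ^ 2 ≤ ∑ j : Fin m, ‖w j.castSucc‖ ^ 2 := fun j =>
    Finset.single_le_sum (f := fun j : Fin m => ‖w j.castSucc‖ ^ 2)
      (fun _ _ => by positivity) (Finset.mem_univ j)
  have hs0 : 0 ≤ ∑ j : Fin m, ‖w j.castSucc‖ ^ 2 := by positivity
  exact ⟨by linarith, by linarith, fun j => by linarith [hs j]⟩

/-- The factor of the majorant that depends on the height above the boundary. -/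
def heightFactor (α t : ℝ) : ℝ := (Ioi 0).indicator (fun t => t ^ α * (1 + t) ^ (-(2 * (α + 1)))) t

theorem heightFactor_nonneg (α t : ℝ) : 0 ≤ heightFactor α t :=
  indicator_nonneg (fun t ht => by have : 0 < t := ht; positivity) t

/-- The factor behaves like `t ^ α` at zero and `t ^ (-α - 2)` at infinity; both are integrable
exactly when `α > -1`. -/
theorem integrable_heightFactor {α : ℝ} (hα : -1 < α) : Integrable (heightFactor α) := by
  have hm : Measurable fun t : ℝ => t ^ α * (1 + t) ^ (-(2 * (α + 1))) := by fun_prop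
  refine (integrable_indicator_iff measurableSet_Ioi).2 ?_
  rw [← Ioc_union_Ioi_eq_Ioi zero_le_one]
  refine IntegrableOn.union ?_ ?_
  · have h1 : IntegrableOn (fun t : ℝ => t ^ α) (Ioc 0 1) :=
      (intervalIntegrable_iff_integrableOn_Ioc_of_le zero_le_one).1
        (intervalIntegral.intervalIntegrable_rpow' hα)
    refine h1.mono' hm.aestronglyMeasurable ?_
    refine ae_restrict_of_forall_mem measurableSet_Ioc fun t ht => ?_
    have ht0 : 0 < t := ht.1
    rw [Real.norm_of_nonneg (by positivity)]
    exact mul_le_of_le_one_right (by positivity)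
      (Real.rpow_le_one_of_one_le_of_nonpos (by linarith) (by linarith))
  · have h1 : IntegrableOn (fun t : ℝ => t ^ (-α - 2)) (Ioi 1) :=
      integrableOn_Ioi_rpow_of_lt (by linarith) zero_lt_one
    refine h1.mono' hm.aestronglyMeasurable ?_
    refine ae_restrict_of_forall_mem measurableSet_Ioi fun t ht => ?_
    have ht0 : 0 < t := zero_lt_one.trans ht
    rw [Real.norm_of_nonneg (by positivity)]
    calc t ^ α * (1 + t) ^ (-(2 * (α + 1))) ≤ t ^ α * t ^ (-(2 * (α + 1))) := by
          refine mul_le_mul_of_nonneg_left ?_ (by positivity)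
          exact Real.rpow_le_rpow_of_nonpos ht0 (by linarith) (by linarith)
      _ = t ^ (-α - 2) := by rw [← Real.rpow_add ht0]; congr 1; ring

theorem integrable_halfPlaneFactor {α : ℝ} (hα : -1 < α) :
    Integrable fun ζ : ℂ => (1 + |ζ.re|) ^ (-2 : ℝ) * heightFactor α ζ.im := by
  have h1 : Integrable fun u : ℝ => (1 + |u|) ^ (-2 : ℝ) :=
    integrable_one_add_norm (E := ℝ) (by simp)
  exact (Complex.volume_preserving_equiv_real_prod.integrable_comp_emb
    Complex.measurableEquivRealProd.measurableEmbedding).2 (h1.mul_prod (integrable_heightFactor hα))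

theorem integrable_horizontalFactor :
    Integrable fun x : Fin m → ℂ => ∏ j, (1 + ‖x j‖ ^ 2) ^ (-2 : ℝ) := by
  refine Integrable.fintype_prod (f := fun (_ : Fin m) (u : ℂ) => (1 + ‖u‖ ^ 2) ^ (-2 : ℝ))
    fun _ => ?_
  have := integrable_rpow_neg_one_add_norm_sq (E := ℂ) (μ := volume) (r := 4)
    (by rw [Complex.finrank_real_complex]; norm_num)
  norm_num at this ⊢
  exact this

/-- The exponent `2 (n + α + 1)` is shared out as `2` for the flattened real part, `2 (α + 1)` for
the height and `2` for each of the `m` horizontal coordinates, giving a product majorant. -/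
theorem rpow_div_norm_rho₂_le {α : ℝ} (hα : -1 < α) {w : Cn m} (hw : w ∈ tubeDomain m) :
    rho w ^ α / ‖rho₂ w (basePoint m)‖ ^ (2 * (((m + 1 : ℕ) : ℝ) + α + 1)) ≤
      4 ^ (2 * (((m + 1 : ℕ) : ℝ) + α + 1)) *
        ((1 + |(w (Fin.last m) - flattenShift fun j => w j.castSucc).re|) ^ (-2 : ℝ) *
          heightFactor α (w (Fin.last m) - flattenShift fun j => w j.castSucc).im *
          ∏ j : Fin m, (1 + ‖w j.castSucc‖ ^ 2) ^ (-2 : ℝ)) := by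
  obtain ⟨h1, h2, h3⟩ := le_four_mul_norm_rho₂ hw
  have hp := mem_tubeDomain_iff.1 hw
  have hR := norm_rho₂_pos hw (basePoint_mem (m := m))
  rw [im_sub_flattenShift]
  set u := (w (Fin.last m) - flattenShift fun j => w j.castSucc).re
  set R := ‖rho₂ w (basePoint m)‖
  rw [heightFactor, indicator_of_mem (show rho w ∈ Ioi 0 from hp), div_le_iff₀ (by positivity)]
  have e1 : (4 * R) ^ (2 * (((m + 1 : ℕ) : ℝ) + α + 1)) =
      (4 * R) ^ (2 : ℝ) * (4 * R) ^ (2 * (α + 1)) * ∏ _j : Fin m, (4 * R) ^ (2 : ℝ) := by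
    rw [Finset.prod_const, Finset.card_univ, Fintype.card_fin, ← Real.rpow_mul_natCast
      (by positivity), ← Real.rpow_add (by positivity), ← Real.rpow_add (by positivity)]
    congr 1; push_cast; ring
  have f1 : 1 ≤ (1 + |u|) ^ (-2 : ℝ) * (4 * R) ^ (2 : ℝ) := by
    rw [Real.rpow_neg (by positivity), inv_mul_eq_div, one_le_div (by positivity)]
    exact Real.rpow_le_rpow (by positivity) h2 (by norm_num)
  have f2 : 1 ≤ (1 + rho w) ^ (-(2 * (α + 1))) * (4 * R) ^ (2 * (α + 1)) := by
    rw [Real.rpow_neg (by positivity), inv_mul_eq_div, one_le_div (by positivity)]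
    exact Real.rpow_le_rpow (by positivity) h1 (by linarith)
  have f3 : 1 ≤ ∏ j : Fin m, (1 + ‖w j.castSucc‖ ^ 2) ^ (-2 : ℝ) * (4 * R) ^ (2 : ℝ) := by
    refine Finset.one_le_prod fun j _ => ?_
    rw [Real.rpow_neg (by positivity), inv_mul_eq_div, one_le_div (by positivity)]
    exact Real.rpow_le_rpow (by positivity) (h3 j) (by norm_num)
  rw [Finset.prod_mul_distrib] at f3
  calc rho w ^ α = rho w ^ α * (1 * 1 * 1) := by ring
    _ ≤ rho w ^ α * (((1 + |u|) ^ (-2 : ℝ) * (4 * R) ^ (2 : ℝ)) *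
          ((1 + rho w) ^ (-(2 * (α + 1))) * (4 * R) ^ (2 * (α + 1))) *
          ((∏ j : Fin m, (1 + ‖w j.castSucc‖ ^ 2) ^ (-2 : ℝ)) *
            ∏ _j : Fin m, (4 * R) ^ (2 : ℝ))) := by gcongr
    _ = rho w ^ α * (1 + |u|) ^ (-2 : ℝ) * (1 + rho w) ^ (-(2 * (α + 1))) *
          (∏ j : Fin m, (1 + ‖w j.castSucc‖ ^ 2) ^ (-2 : ℝ)) *
          (4 * R) ^ (2 * (((m + 1 : ℕ) : ℝ) + α + 1)) := by rw [e1]; ring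
    _ = _ := by rw [Real.mul_rpow (by norm_num) hR.le]; ring

/-- Integration in flattened coordinates. -/
theorem lintegral_flatten {G : ℂ → ℝ≥0∞} (hG : Measurable G) {H : (Fin m → ℂ) → ℝ≥0∞}
    (hH : Measurable H) :
    ∫⁻ w : Cn m, G (w (Fin.last m) - flattenShift fun j => w j.castSucc) *
      H (fun j => w j.castSucc) = (∫⁻ ζ, G ζ) * ∫⁻ x, H x := by
  have hs : Measurable (flattenShift : (Fin m → ℂ) → ℂ) := by
    unfold flattenShift; fun_prop
  have hmeas : Measurable fun q : ℂ × (Fin m → ℂ) => G (q.1 - flattenShift q.2) * H q.2 := by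
    fun_prop
  have h1 := (volume_preserving_piFinSuccAbove (fun _ : Fin (m + 1) => ℂ)
    (Fin.last m)).lintegral_comp hmeas
  have h2 : ∀ w : Cn m, MeasurableEquiv.piFinSuccAbove (fun _ => ℂ) (Fin.last m) w =
      (w (Fin.last m), fun j => w j.castSucc) := fun w => by
    refine Prod.ext rfl (funext fun j => ?_)
    change w ((Fin.last m).succAbove j) = _
    rw [Fin.succAbove_last]
  simp only [h2] at h1
  rw [h1, Measure.volume_eq_prod, lintegral_prod_symm' _ hmeas]
  have h3 : ∀ x : Fin m → ℂ, ∫⁻ ζ, G (ζ - flattenShift x) * H x = (∫⁻ ζ, G ζ) * H x := fun x => by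
    rw [lintegral_mul_const _ (by fun_prop), lintegral_sub_right_eq_self G]
  simp only [h3]
  rw [lintegral_const_mul _ hH]

theorem lintegral_rpow_div_norm_rho₂_basePoint_lt_top {α : ℝ} (hα : -1 < α) :
    ∫⁻ w in tubeDomain m, ENNReal.ofReal
      (rho w ^ α / ‖rho₂ w (basePoint m)‖ ^ (2 * (((m + 1 : ℕ) : ℝ) + α + 1))) < ⊤ := by
  have hG := (integrable_halfPlaneFactor hα)
  have hH := (integrable_horizontalFactor (m := m))
  have hheight : Measurable (heightFactor α) :=
    (by fun_prop : Measurable fun t : ℝ => t ^ α * (1 + t) ^ (-(2 * (α + 1)))).indicator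
      measurableSet_Ioi
  set C := (4 : ℝ) ^ (2 * (((m + 1 : ℕ) : ℝ) + α + 1))
  calc _ ≤ ∫⁻ w in tubeDomain m, ENNReal.ofReal C * (ENNReal.ofReal
          ((1 + |(w (Fin.last m) - flattenShift fun j => w j.castSucc).re|) ^ (-2 : ℝ) *
          heightFactor α (w (Fin.last m) - flattenShift fun j => w j.castSucc).im) *
          ENNReal.ofReal (∏ j : Fin m, (1 + ‖w j.castSucc‖ ^ 2) ^ (-2 : ℝ))) := by
        refine setLIntegral_mono' measurableSet_tubeDomain fun w hw => ?_
        have h0 := heightFactor_nonneg α (w (Fin.last m) - flattenShift fun j => w j.castSucc).im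
        rw [← ENNReal.ofReal_mul (by positivity), ← ENNReal.ofReal_mul (by positivity)]
        exact ENNReal.ofReal_le_ofReal (rpow_div_norm_rho₂_le hα hw)
    _ ≤ _ := setLIntegral_le_lintegral _ _
    _ = ENNReal.ofReal C * ((∫⁻ ζ : ℂ, ENNReal.ofReal
          ((1 + |ζ.re|) ^ (-2 : ℝ) * heightFactor α ζ.im)) *
          ∫⁻ x : Fin m → ℂ, ENNReal.ofReal (∏ j, (1 + ‖x j‖ ^ 2) ^ (-2 : ℝ))) := by
        rw [lintegral_const_mul' _ _ ENNReal.ofReal_ne_top, lintegral_flatten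
          (G := fun ζ => ENNReal.ofReal ((1 + |ζ.re|) ^ (-2 : ℝ) * heightFactor α ζ.im))
          (H := fun x => ENNReal.ofReal (∏ j, (1 + ‖x j‖ ^ 2) ^ (-2 : ℝ)))]
        · have : Measurable fun ζ : ℂ => (1 + |ζ.re|) ^ (-2 : ℝ) :=
            (by fun_prop : Measurable fun u : ℝ => (1 + |u|) ^ (-2 : ℝ)).comp Complex.measurable_re
          exact (this.mul (hheight.comp Complex.measurable_im)).ennreal_ofReal
        · fun_prop
    _ < ⊤ := ENNReal.mul_lt_top ENNReal.ofReal_lt_top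
        (ENNReal.mul_lt_top hG.lintegral_lt_top hH.lintegral_lt_top)

/-- By homogeneity the Forelli–Rudin integral does not depend on the pole. -/
theorem lintegral_testFunction (α : ℝ) (a : tubeDomain m) :
    ∫⁻ z in tubeDomain m, ENNReal.ofReal (rho (a : Cn m) ^ (((m + 1 : ℕ) : ℝ) + α + 1) /
      ‖rho₂ z a‖ ^ (2 * (((m + 1 : ℕ) : ℝ) + α + 1))) * ENNReal.ofReal (rho z ^ α) =
    ∫⁻ w in tubeDomain m, ENNReal.ofReal
      (rho w ^ α / ‖rho₂ w (basePoint m)‖ ^ (2 * (((m + 1 : ℕ) : ℝ) + α + 1))) := by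
  have ha := rho_pos a
  rw [← lintegral_indicator measurableSet_tubeDomain,
    ← lintegral_indicator measurableSet_tubeDomain, lintegral_tubeAut a,
    ← lintegral_const_mul' _ _ ENNReal.ofReal_ne_top]
  refine lintegral_congr fun w => ?_
  by_cases hw : w ∈ tubeDomain m
  · rw [indicator_of_mem hw, indicator_of_mem (tubeAut_mem.2 hw), rho_tubeAut,
      rho₂_tubeAut_basePoint, norm_mul, Complex.norm_real, Real.norm_of_nonneg ha.le]
    have hp := mem_tubeDomain_iff.1 hw
    have hR := norm_rho₂_pos hw (basePoint_mem (m := m))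
    rw [← ENNReal.ofReal_mul (by positivity), ← ENNReal.ofReal_mul (by positivity)]
    congr 1
    rw [Real.mul_rpow ha.le (norm_nonneg _), Real.mul_rpow ha.le hp.le, mul_comm 2, Real.rpow_mul
      ha.le]
    have e : rho (a : Cn m) ^ (((m + 1 : ℕ) : ℝ) + α + 1) =
        rho (a : Cn m) ^ (m + 2) * rho (a : Cn m) ^ α := by
      rw [← Real.rpow_natCast, ← Real.rpow_add ha]
      congr 1; push_cast; ring
    rw [e, Real.rpow_two]
    field_simp
  · rw [indicator_of_notMem hw, indicator_of_notMem (fun h => hw (tubeAut_mem.1 h)), mul_zero]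

/-! ### The test functions and the Berezin integral -/

/-- The real part of `ρ₂` bounds `w'`; solving the definition of `ρ₂` for the last coordinate bounds
that too. Hence `|ρ₂(z, a)|` tends to infinity with `|a|`, uniformly for bounded `z`. -/
theorem exists_norm_le_of_norm_rho₂_le (m : ℕ) (C M : ℝ) :
    ∃ B : ℝ, ∀ z w : Cn m, z ∈ tubeDomain m → w ∈ tubeDomain m → ‖z‖ ≤ M → ‖rho₂ z w‖ ≤ C →
      √(∑ i, ‖w i‖ ^ 2) ≤ B := by
  set M' := M + 2 * √C with hM'
  set B := max M' (M + (2 * C + (∑ _j : Fin m, (M + M') ^ 2) / 2)) with hB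
  refine ⟨√(∑ _i : Fin (m + 1), B ^ 2), fun z w hz hw hzM hC => ?_⟩
  have hzk : ∀ k, ‖z k‖ ≤ M := fun k => (norm_le_pi_norm z k).trans hzM
  have hC0 : 0 ≤ C := (norm_nonneg _).trans hC
  have hwj : ∀ j : Fin m, ‖w j.castSucc‖ ≤ M' := fun j => by
    have h1 := (Complex.re_le_norm (rho₂ z w)).trans hC
    rw [re_rho₂] at h1
    have h2 : ‖z j.castSucc - w j.castSucc‖ ^ 2 ≤
        ∑ j : Fin m, ‖z j.castSucc - w j.castSucc‖ ^ 2 :=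
      Finset.single_le_sum (f := fun j : Fin m => ‖z j.castSucc - w j.castSucc‖ ^ 2)
        (fun _ _ => by positivity) (Finset.mem_univ j)
    have hz0 := mem_tubeDomain_iff.1 hz
    have hw0 := mem_tubeDomain_iff.1 hw
    have h3 : ‖z j.castSucc - w j.castSucc‖ ≤ 2 * √C := by
      refine le_of_sq_le_sq ?_ (by positivity)
      rw [mul_pow, Real.sq_sqrt hC0]
      linarith
    calc ‖w j.castSucc‖ = ‖z j.castSucc - (z j.castSucc - w j.castSucc)‖ := by ring_nf
      _ ≤ M' := (norm_sub_le _ _).trans (add_le_add (hzk _) h3)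
  have hwn : ‖w (Fin.last m)‖ ≤ M + (2 * C + (∑ _j : Fin m, (M + M') ^ 2) / 2) := by
    have e : starRingEnd ℂ (w (Fin.last m)) = z (Fin.last m) -
        (2 * Complex.I * rho₂ z w
          - (Complex.I / 2) * ∑ j : Fin m, (z j.castSucc - starRingEnd ℂ (w j.castSucc)) ^ 2) := by
      rw [rho₂]
      linear_combination (-(z (Fin.last m) - starRingEnd ℂ (w (Fin.last m)))) * Complex.I_sq
    have hs : ‖∑ j : Fin m, (z j.castSucc - starRingEnd ℂ (w j.castSucc)) ^ 2‖ ≤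
        ∑ _j : Fin m, (M + M') ^ 2 := by
      refine norm_sum_le_of_le _ fun j _ => ?_
      rw [norm_pow]
      gcongr
      refine (norm_sub_le _ _).trans (add_le_add (hzk _) ?_)
      rw [RCLike.norm_conj]
      exact hwj j
    rw [← RCLike.norm_conj (w (Fin.last m)), e]
    refine (norm_sub_le _ _).trans (add_le_add (hzk _) ((norm_sub_le _ _).trans ?_))
    have n1 : ‖2 * Complex.I * rho₂ z w‖ = 2 * ‖rho₂ z w‖ := by simp
    have n2 : ‖(Complex.I / 2) * ∑ j : Fin m,
        (z j.castSucc - starRingEnd ℂ (w j.castSucc)) ^ 2‖ =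
        ‖∑ j : Fin m, (z j.castSucc - starRingEnd ℂ (w j.castSucc)) ^ 2‖ / 2 := by
      simp; ring
    rw [n1, n2]
    linarith
  refine Real.sqrt_le_sqrt (Finset.sum_le_sum fun i _ => ?_)
  gcongr
  refine Fin.lastCases ?_ (fun j => ?_) i
  · exact hwn.trans (le_max_right _ _)
  · exact (hwj j).trans (le_max_left _ _)

theorem eventually_rho_div_sq_norm_rho₂_le {K : Set (Cn m)} (hK : IsCompact K)
    (hT : K ⊆ tubeDomain m) {η : ℝ} (hη : 0 < η) :
    ∀ᶠ a : tubeDomain m in boundaryFilter m, ∀ z ∈ K, rho (a : Cn m) / ‖rho₂ z a‖ ^ 2 ≤ η := by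
  obtain rfl | hne := K.eq_empty_or_nonempty
  · simp
  refine eventually_sup.2 ⟨?_, ?_⟩
  · obtain ⟨z₀, hz₀, hmin⟩ := hK.exists_isMinOn hne continuous_rho.continuousOn
    have hδ := mem_tubeDomain_iff.1 (hT hz₀)
    have hev : ∀ᶠ x in 𝓝 (0 : ℝ), x < η * (rho z₀ / 2) ^ 2 := Iio_mem_nhds (by positivity)
    filter_upwards [hev.comap fun z : tubeDomain m => rho (z : Cn m)] with a ha z hz
    have h1 : rho z₀ / 2 ≤ ‖rho₂ z a‖ := by
      refine le_trans ?_ (Complex.re_le_norm _)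
      rw [re_rho₂]
      have h2 : rho z₀ ≤ rho z := hmin hz
      have h3 : 0 ≤ ∑ j : Fin m, ‖z j.castSucc - (a : Cn m) j.castSucc‖ ^ 2 := by positivity
      linarith [rho_pos a]
    have h2 := norm_rho₂_pos (hT hz) a.2
    rw [div_le_iff₀ (by positivity)]
    exact ha.le.trans (by gcongr)
  · obtain ⟨M, hM⟩ := hK.isBounded.exists_norm_le
    -- Since `ρ(a) ≤ 2 |ρ₂(z, a)|`, the quotient is at most `2 / |ρ₂(z, a)|`, so the threshold `2 /
    -- η` suffices.
    obtain ⟨B, hB⟩ := exists_norm_le_of_norm_rho₂_le m (2 / η) M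
    filter_upwards [(eventually_gt_atTop B).comap
      fun z : tubeDomain m => √(∑ i, ‖(z : Cn m) i‖ ^ 2)] with a ha z hz
    have h1 : 2 / η < ‖rho₂ z a‖ := by
      by_contra h
      exact absurd (hB z a (hT hz) a.2 (hM z hz) (not_lt.1 h)) (not_le.2 ha)
    have h2 := norm_rho₂_pos (hT hz) a.2
    have h3 : rho (a : Cn m) ≤ 2 * ‖rho₂ z a‖ := by
      have h4 := Complex.re_le_norm (rho₂ z a)
      rw [re_rho₂] at h4
      have h5 : 0 ≤ ∑ j : Fin m, ‖z j.castSucc - (a : Cn m) j.castSucc‖ ^ 2 := by positivity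
      linarith [mem_tubeDomain_iff.1 (hT hz)]
    rw [div_lt_iff₀ hη] at h1
    rw [div_le_iff₀ (by positivity)]
    nlinarith

/-- The normalized power of the kernel with pole `a`. -/
def testFunction (p s : ℝ) (a : tubeDomain m) (z : Cn m) : ℂ :=
  ((rho (a : Cn m) ^ (s / p) : ℝ) : ℂ) * rho₂ z a ^ ((-(2 * s / p) : ℝ) : ℂ)

theorem norm_testFunction {p s : ℝ} (a : tubeDomain m) {z : Cn m}
    (hz : z ∈ tubeDomain m) :
    ‖testFunction p s a z‖ = (rho (a : Cn m) / ‖rho₂ z a‖ ^ 2) ^ (s / p) := by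
  have ha := rho_pos a
  have h2 := norm_rho₂_pos hz a.2
  rw [testFunction, norm_mul, Complex.norm_real, Complex.norm_cpow_real,
    Real.norm_of_nonneg (by positivity), Real.div_rpow ha.le (by positivity), ← Real.rpow_two,
    ← Real.rpow_mul h2.le, Real.rpow_neg h2.le, ← div_eq_mul_inv, mul_div_assoc]

theorem enorm_testFunction_rpow {p s : ℝ} (hp : 0 < p) (a : tubeDomain m) {z : Cn m}
    (hz : z ∈ tubeDomain m) :
    ‖testFunction p s a z‖ₑ ^ p =
      ENNReal.ofReal (rho (a : Cn m) ^ s / ‖rho₂ z a‖ ^ (2 * s)) := by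
  have ha := rho_pos a
  have h2 := norm_rho₂_pos hz a.2
  rw [← ofReal_norm, ENNReal.ofReal_rpow_of_nonneg (norm_nonneg _) hp.le,
    norm_testFunction a hz, ← Real.rpow_mul (by positivity), div_mul_cancel₀ _ hp.ne',
    Real.div_rpow ha.le (by positivity), ← Real.rpow_two, ← Real.rpow_mul h2.le]

/-- The principal power is holomorphic because `Re ρ₂ > 0` on the domain. -/
theorem differentiableOn_testFunction (p s : ℝ) (a : tubeDomain m) :
    DifferentiableOn ℂ (testFunction p s a) (tubeDomain m) := by
  intro z hz
  have h1 : DifferentiableAt ℂ (fun z : Cn m => rho₂ z a) z := by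
    unfold rho₂; fun_prop
  exact ((h1.cpow (differentiableAt_const _)
    (Complex.mem_slitPlane_iff.2 (Or.inl (rho₂_re_pos hz a.2)))).const_mul _).differentiableWithinAt

theorem bergmanENorm_testFunction {p α : ℝ} (hp : 0 < p) (a : tubeDomain m) :
    bergmanENorm p α (testFunction p (((m + 1 : ℕ) : ℝ) + α + 1) a) =
      (∫⁻ w in tubeDomain m, ENNReal.ofReal
      (rho w ^ α / ‖rho₂ w (basePoint m)‖ ^ (2 * (((m + 1 : ℕ) : ℝ) + α + 1)))) ^ (1 / p) := by
  rw [bergmanENorm, ← lintegral_testFunction α a]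
  congr 1
  refine setLIntegral_congr_fun measurableSet_tubeDomain fun z hz => ?_
  rw [enorm_testFunction_rpow hp a hz]

theorem tendstoUniformlyOn_testFunction {p s : ℝ} (hp : 0 < p) (hs : 0 < s)
    {a : ℕ → tubeDomain m} (ha : Tendsto a atTop (boundaryFilter m)) {K : Set (Cn m)}
    (hT : K ⊆ tubeDomain m) (hK : IsCompact K) :
    TendstoUniformlyOn (fun k => testFunction p s (a k)) 0 atTop K := by
  rw [Metric.tendstoUniformlyOn_iff]
  intro ε hε
  have hsp : 0 < s / p := by positivity
  have hη : 0 < (ε / 2) ^ (s / p)⁻¹ := by positivity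
  filter_upwards [ha.eventually (eventually_rho_div_sq_norm_rho₂_le hK hT hη)] with k hk z hz
  have h2 := norm_rho₂_pos (hT hz) (a k).2
  have h3 := rho_pos (a k)
  rw [Pi.zero_apply, dist_zero_left, norm_testFunction _ (hT hz)]
  calc _ ≤ ((ε / 2) ^ (s / p)⁻¹) ^ (s / p) := by gcongr; exact hk z hz
    _ = ε / 2 := Real.rpow_inv_rpow (by positivity) hsp.ne'
    _ < ε := by linarith

variable {p r α : ℝ} {μ : Measure (tubeDomain m)}

/-- Carleson vanishing concerns sequences; countable generation lets the boundary limit be tested on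
sequences. -/
instance : (boundaryFilter m).IsCountablyGenerated := by
  unfold boundaryFilter; infer_instance

theorem IsVanishingCarleson.tendsto_berezinIntegral (hp : 0 < p) (hα : -1 < α)
    (h : IsVanishingCarleson p α μ) :
    Tendsto (berezinIntegral α μ) (boundaryFilter m) (𝓝 0) := by
  refine tendsto_of_seq_tendsto fun a ha => ?_
  have hm : (0 : ℝ) ≤ (m + 1 : ℕ) := by positivity
  have hs : 0 < ((m + 1 : ℕ) : ℝ) + α + 1 := by linarith
  have hI := (ENNReal.rpow_lt_top_of_nonneg (y := 1 / p) (by positivity)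
    (lintegral_rpow_div_norm_rho₂_basePoint_lt_top (m := m) hα).ne)
  have h1 := h (fun k => testFunction p (((m + 1 : ℕ) : ℝ) + α + 1) (a k))
    (fun k => ⟨differentiableOn_testFunction _ _ _, by rwa [bergmanENorm_testFunction hp]⟩)
    ⟨_, fun k => by rw [bergmanENorm_testFunction hp]; exact (ENNReal.coe_toNNReal hI.ne).ge⟩
    (fun K hT hK => tendstoUniformlyOn_testFunction hp hs ha hT hK)
  refine h1.congr fun k => lintegral_congr fun z => ?_
  exact enorm_testFunction_rpow hp (a k) z.2

/-! ### Comparison of `ρ` on Bergman balls, and averages over balls. -/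

theorem exists_rho₂_le_of_mem_bergmanBall (m : ℕ) (r : ℝ) :
    ∃ C > 0, ∀ a w : tubeDomain m, w ∈ bergmanBall a r →
      ‖rho₂ (w : Cn m) a‖ ≤ C * rho (a : Cn m) := by
  obtain ⟨K, hT, hK, h⟩ := exists_isCompact_of_bergmanDist_lt m r
  obtain ⟨C, hC⟩ := hK.exists_bound_of_continuousOn (continuous_rho₂_left (basePoint m)).continuousOn
  refine ⟨max C 1, by positivity, fun a w hw => ?_⟩
  rw [mem_bergmanBall, bergmanDist_eq_tubeAutInv] at hw
  have h1 := hC _ (h _ (tubeAutInv_mem.2 w.2) hw)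
  have ha := rho_pos a
  rw [← tubeAut_tubeAutInv a (w : Cn m), rho₂_tubeAut_basePoint, norm_mul, Complex.norm_real,
    Real.norm_of_nonneg ha.le, mul_comm]
  gcongr
  exact h1.trans (le_max_left _ _)

/-- With the two centres exchanged, `ρ(a) ≤ 2 Re ρ₂(a, w) ≤ 2 C ρ(w)`. -/
theorem exists_le_rho_of_mem_bergmanBall (m : ℕ) (r : ℝ) :
    ∃ c > 0, ∀ a w : tubeDomain m, w ∈ bergmanBall a r → c * rho (a : Cn m) ≤ rho (w : Cn m) := by
  obtain ⟨C, hC, h⟩ := exists_rho₂_le_of_mem_bergmanBall m r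
  refine ⟨(2 * C)⁻¹, by positivity, fun a w hw => ?_⟩
  have h1 := h w a (mem_bergmanBall_comm.1 hw)
  have h2 := Complex.re_le_norm (rho₂ (a : Cn m) w)
  rw [re_rho₂] at h2
  have h3 : 0 ≤ ∑ j : Fin m, ‖(a : Cn m) j.castSucc - (w : Cn m) j.castSucc‖ ^ 2 := by positivity
  rw [inv_mul_le_iff₀ (by positivity)]
  linarith [rho_pos w]

/-- The Berezin integral dominates the averages over Bergman balls. -/
theorem exists_ballRatio_le (μ : Measure (tubeDomain m)) (r : ℝ) (hα : -1 < α) :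
    ∃ C : ℝ≥0∞, C ≠ ⊤ ∧ ∀ a, ballRatio α r μ a ≤ C * berezinIntegral α μ a := by
  obtain ⟨C, hC, h⟩ := exists_rho₂_le_of_mem_bergmanBall m r
  set s := ((m + 1 : ℕ) : ℝ) + α + 1 with hs
  have hm : (0 : ℝ) ≤ (m + 1 : ℕ) := by positivity
  have hs0 : 0 < s := by linarith
  refine ⟨ENNReal.ofReal (C ^ (2 * s)), ENNReal.ofReal_ne_top, fun a => ?_⟩
  have ha := rho_pos a
  have h1 : ENNReal.ofReal ((C ^ (2 * s) * rho (a : Cn m) ^ s)⁻¹) * μ (bergmanBall a r) ≤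
      berezinIntegral α μ a := by
    rw [← setLIntegral_const]
    refine (setLIntegral_mono' (isOpen_bergmanBall a r).measurableSet fun w hw => ?_).trans
      (setLIntegral_le_lintegral _ _)
    refine ENNReal.ofReal_le_ofReal ?_
    rw [← hs]
    have hR := norm_rho₂_pos w.2 a.2
    rw [le_div_iff₀ (by positivity), inv_mul_le_iff₀ (by positivity)]
    calc ‖rho₂ (w : Cn m) a‖ ^ (2 * s) ≤ (C * rho (a : Cn m)) ^ (2 * s) :=
          Real.rpow_le_rpow hR.le (h a w hw) (by positivity)
      _ = C ^ (2 * s) * rho (a : Cn m) ^ s * rho (a : Cn m) ^ s := by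
          rw [Real.mul_rpow hC.le ha.le, two_mul s, Real.rpow_add ha]; ring
  calc ballRatio α r μ a = ENNReal.ofReal (C ^ (2 * s)) *
        (ENNReal.ofReal ((C ^ (2 * s) * rho (a : Cn m) ^ s)⁻¹) * μ (bergmanBall a r)) := by
        rw [ballRatio, ← mul_assoc, ← ENNReal.ofReal_mul (by positivity), mul_inv,
          mul_inv_cancel_left₀ (by positivity), ENNReal.ofReal_inv_of_pos (by positivity),
          mul_comm, ENNReal.div_eq_inv_mul, mul_comm]
    _ ≤ _ := by gcongr

theorem tendsto_ballRatio_of_berezinIntegral (r : ℝ) (hα : -1 < α)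
    (h : Tendsto (berezinIntegral α μ) (boundaryFilter m) (𝓝 0)) :
    Tendsto (ballRatio α r μ) (boundaryFilter m) (𝓝 0) := by
  obtain ⟨C, hC, hle⟩ := exists_ballRatio_le μ r hα
  have h1 := ENNReal.Tendsto.const_mul (a := C) h (Or.inr hC)
  rw [mul_zero] at h1
  exact tendsto_of_tendsto_of_tendsto_of_le_of_le tendsto_const_nhds h1 (fun _ => zero_le) hle

/-! ### Sums over a lattice -/

/-- Beyond some `J` the factors `c j` are below `δ`, so the tail is at most `δ M` for every `k`; the
head is a finite sum of null sequences. -/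
theorem tendsto_tsum_zero_of_le_mul {T A : ℕ → ℕ → ℝ≥0∞} {c : ℕ → ℝ≥0∞} {M : ℝ≥0∞} (hM : M ≠ ⊤)
    (hT : ∀ k j, T k j ≤ c j * A k j) (hA : ∀ k, ∑' j, A k j ≤ M)
    (hc : Tendsto c atTop (𝓝 0)) (h : ∀ j, Tendsto (fun k => T k j) atTop (𝓝 0)) :
    Tendsto (fun k => ∑' j, T k j) atTop (𝓝 0) := by
  rw [ENNReal.tendsto_nhds_zero]
  intro ε hε
  obtain ⟨δ, hδ, hδM⟩ := ENNReal.exists_nnreal_pos_mul_lt hM (ENNReal.half_pos hε.ne').ne'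
  obtain ⟨J, hJ⟩ := eventually_atTop.1
    (ENNReal.tendsto_nhds_zero.1 hc δ (by exact_mod_cast hδ))
  have hfin : Tendsto (fun k => ∑ j ∈ Finset.range J, T k j) atTop (𝓝 0) := by
    simpa using tendsto_finsetSum (Finset.range J) fun j _ => h j
  filter_upwards [ENNReal.tendsto_nhds_zero.1 hfin (ε / 2) (ENNReal.half_pos hε.ne')] with k hk
  rw [← Summable.sum_add_tsum_nat_add' (k := J) ENNReal.summable, ← ENNReal.add_halves ε]
  refine add_le_add hk (le_trans ?_ hδM.le)
  calc ∑' j, T k (j + J) ≤ ∑' j, δ * A k (j + J) :=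
        ENNReal.tsum_le_tsum fun j => (hT k _).trans (by gcongr; exact hJ _ (by omega))
    _ = δ * ∑' j, A k (j + J) := ENNReal.tsum_mul_left
    _ ≤ δ * M := by
        gcongr
        exact (ENNReal.tsum_comp_le_tsum_of_injective (add_left_injective J) (A k)).trans (hA k)

theorem tsum_setLIntegral_le {X : Type*} [MeasurableSpace X] {ν : Measure X} {T : Set X}
    {D : ℕ → Set X} (hD : ∀ j, MeasurableSet (D j)) (hDT : ∀ j, D j ⊆ T) (hT : MeasurableSet T)
    {N : ℕ} (hN : ∀ w ∈ T, {j | w ∈ D j}.encard ≤ N) {g : X → ℝ≥0∞}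
    (hg : AEMeasurable g (ν.restrict T)) :
    ∑' j, ∫⁻ w in D j, g w ∂ν ≤ N * ∫⁻ w in T, g w ∂ν := by
  have h1 : ∀ j, ∫⁻ w in D j, g w ∂ν = ∫⁻ w in T, (D j).indicator g w ∂ν := fun j => by
    rw [lintegral_indicator (hD j), Measure.restrict_restrict (hD j),
      inter_eq_left.2 (hDT j)]
  simp only [h1]
  rw [← lintegral_tsum fun j => hg.indicator (hD j),
    ← lintegral_const_mul' _ _ (ENNReal.natCast_ne_top N)]
  refine setLIntegral_mono' hT fun w hw => ?_
  have h2 : ∑' j, (D j).indicator g w = ∑' j, {j | w ∈ D j}.indicator (fun _ => g w) j :=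
    tsum_congr fun j => rfl
  rw [h2, ← tsum_subtype, ENNReal.tsum_set_const]
  gcongr
  exact_mod_cast hN w hw

theorem tendsto_setLIntegral_zero {f : ℕ → Cn m → ℂ} (hp : 0 < p) [IsFiniteMeasureOnCompacts μ]
    (hf : ∀ K ⊆ tubeDomain m, IsCompact K → TendstoUniformlyOn f 0 atTop K)
    {K : Set (tubeDomain m)} (hK : IsCompact K) :
    Tendsto (fun k => ∫⁻ z in K, ‖f k z‖ₑ ^ p ∂μ) atTop (𝓝 0) := by
  have hu := hf ((↑) '' K) (by rintro _ ⟨z, -, rfl⟩; exact z.2)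
    (hK.image continuous_subtype_val)
  have hb : Tendsto (fun k => ⨆ z ∈ K, ‖f k z‖ₑ) atTop (𝓝 0) := by
    refine ENNReal.tendsto_nhds_zero.2 fun ε hε => ?_
    filter_upwards [EMetric.tendstoUniformlyOn_iff.1 hu ε hε] with k hk
    refine iSup₂_le fun z hz => ?_
    have := hk z (mem_image_of_mem _ hz)
    rw [Pi.zero_apply, edist_zero_left] at this
    exact this.le
  have h1 : Tendsto (fun k => (⨆ z ∈ K, ‖f k z‖ₑ) ^ p * μ K) atTop (𝓝 0) := by
    have h2 := (ENNReal.continuous_rpow_const (y := p)).continuousAt.tendsto.comp hb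
    rw [ENNReal.zero_rpow_of_pos hp] at h2
    simpa using ENNReal.Tendsto.mul_const h2 (Or.inr hK.measure_lt_top.ne)
  refine tendsto_of_tendsto_of_tendsto_of_le_of_le tendsto_const_nhds h1
    (fun _ => zero_le) fun k => ?_
  simp only
  rw [← setLIntegral_const]
  refine setLIntegral_mono' hK.measurableSet fun z hz => ?_
  gcongr
  exact le_iSup₂ (f := fun z (_ : z ∈ K) => ‖f k z‖ₑ) z hz

/-- For `z` in `D(a, r)` the sub-mean value bound on `D(z, r) ⊆ D(a, 2r)` is uniform, as `ρ(z)` is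
at least a multiple of `ρ(a)`. The radius `2r` is why lattices control the overlap of doubled balls.
-/
theorem exists_setLIntegral_bergmanBall_le (m : ℕ) (hp : 1 ≤ p) (hr : 0 < r) (hα : -1 < α) :
    ∃ C : ℝ≥0∞, C ≠ ⊤ ∧ ∀ (μ : Measure (tubeDomain m)) (a : tubeDomain m) (f : Cn m → ℂ),
      DifferentiableOn ℂ f (tubeDomain m) →
      ∫⁻ z in bergmanBall a r, ‖f z‖ₑ ^ p ∂μ ≤ ballRatio α r μ a *
        (C * ∫⁻ w in (↑) '' bergmanBall a (2 * r), ‖f w‖ₑ ^ p * ENNReal.ofReal (rho w ^ α)) := by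
  obtain ⟨C, hC, h⟩ := exists_enorm_rpow_le_lintegral_bergmanBall m hp hr α
  obtain ⟨c, hc, hcρ⟩ := exists_le_rho_of_mem_bergmanBall m r
  set s := ((m + 1 : ℕ) : ℝ) + α + 1 with hs
  have hm : (0 : ℝ) ≤ (m + 1 : ℕ) := by positivity
  have hs0 : 0 < s := by linarith
  have hcs : ENNReal.ofReal (c ^ s) ≠ 0 := by simpa using Real.rpow_pos_of_pos hc s
  refine ⟨(ENNReal.ofReal (c ^ s))⁻¹ * C, ENNReal.mul_ne_top (ENNReal.inv_ne_top.2 hcs) hC,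
    fun μ a f hf => ?_⟩
  have ha := rho_pos a
  set I := ∫⁻ w in (↑) '' bergmanBall a (2 * r), ‖f w‖ₑ ^ p * ENNReal.ofReal (rho w ^ α)
  have has : ENNReal.ofReal (rho (a : Cn m) ^ s) ≠ 0 := by
    simpa using Real.rpow_pos_of_pos ha s
  have hpt : ∀ z ∈ bergmanBall a r, ‖f z‖ₑ ^ p ≤
      (ENNReal.ofReal (rho (a : Cn m) ^ s))⁻¹ * ((ENNReal.ofReal (c ^ s))⁻¹ * C * I) :=
    fun z hz => by
    have h1 := h z f hf
    have h2 : ∫⁻ w in (↑) '' bergmanBall z r, ‖f w‖ₑ ^ p * ENNReal.ofReal (rho w ^ α) ≤ I := by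
      refine lintegral_mono_set (image_mono fun w hw => ?_)
      exact bergmanBall_mono a (by linarith) (mem_bergmanBall_add hz hw)
    have h3 : ENNReal.ofReal (rho (a : Cn m) ^ s) * ENNReal.ofReal (c ^ s) ≤
        ENNReal.ofReal (rho (z : Cn m) ^ s) := by
      rw [← ENNReal.ofReal_mul (by positivity), ← Real.mul_rpow ha.le hc.le, mul_comm]
      exact ENNReal.ofReal_le_ofReal (Real.rpow_le_rpow (by positivity) (hcρ a z hz) hs0.le)
    have h4 : ‖f z‖ₑ ^ p * (ENNReal.ofReal (rho (a : Cn m) ^ s) * ENNReal.ofReal (c ^ s)) ≤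
        C * I := (mul_le_mul_right h3 _).trans (h1.trans (mul_le_mul_right h2 _))
    rw [← mul_assoc, ← mul_assoc, ← ENNReal.mul_inv (Or.inl has) (Or.inr hcs), mul_assoc,
      ← ENNReal.div_eq_inv_mul]
    exact (ENNReal.le_div_iff_mul_le (Or.inl (mul_ne_zero has hcs)) (Or.inl
      (ENNReal.mul_ne_top ENNReal.ofReal_ne_top ENNReal.ofReal_ne_top))).2 h4
  calc ∫⁻ z in bergmanBall a r, ‖f z‖ₑ ^ p ∂μ
      ≤ ∫⁻ _z in bergmanBall a r, (ENNReal.ofReal (rho (a : Cn m) ^ s))⁻¹ *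
          ((ENNReal.ofReal (c ^ s))⁻¹ * C * I) ∂μ :=
        setLIntegral_mono' (isOpen_bergmanBall a r).measurableSet hpt
    _ = _ := by rw [setLIntegral_const, ballRatio, ENNReal.div_eq_inv_mul, ← hs]; ring

theorem isVanishingCarleson_of_lattice (hp : 1 ≤ p) (hr : 0 < r) (hα : -1 < α)
    [IsFiniteMeasureOnCompacts μ] {a : ℕ → tubeDomain m} (ha : IsBergmanLattice r a)
    (h : Tendsto (fun k => ballRatio α r μ (a k)) atTop (𝓝 0)) :
    IsVanishingCarleson p α μ := by
  have hp0 : 0 < p := by linarith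
  rintro f hf ⟨M, hM⟩ hlim
  obtain ⟨C, hC, hle⟩ := exists_setLIntegral_bergmanBall_le m hp hr hα
  obtain ⟨N, hN⟩ := ha.overlap
  have hsum : ∀ k, ∑' j, C * ∫⁻ w in (↑) '' bergmanBall (a j) (2 * r),
      ‖f k w‖ₑ ^ p * ENNReal.ofReal (rho w ^ α) ≤ C * (N * (M : ℝ≥0∞) ^ p) := fun k => by
    rw [ENNReal.tsum_mul_left]
    gcongr
    have hcont : ContinuousOn (fun w => rho w ^ α) (tubeDomain m) :=
      continuous_rho.continuousOn.rpow_const fun w hw => Or.inl (mem_tubeDomain_iff.1 hw).ne'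
    have hmeas : AEMeasurable (fun w => ‖f k w‖ₑ ^ p * ENNReal.ofReal (rho w ^ α))
        (volume.restrict (tubeDomain m)) :=
      (((hf k).1.continuousOn.aemeasurable measurableSet_tubeDomain).enorm.pow_const p).mul
        (hcont.aemeasurable measurableSet_tubeDomain).ennreal_ofReal
    refine (tsum_setLIntegral_le (fun j => measurableSet_image_bergmanBall (a j) (2 * r))
      (fun j => by rintro _ ⟨z, -, rfl⟩; exact z.2) measurableSet_tubeDomain (N := N)
      (fun w hw => ?_) hmeas).trans ?_
    · refine le_trans (le_of_eq ?_) (hN ⟨w, hw⟩)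
      congr 1
      ext j
      simp [hw]
    · gcongr
      have h1 := ENNReal.rpow_le_rpow (hM k) hp0.le
      rwa [bergmanENorm, ← ENNReal.rpow_mul, one_div_mul_cancel hp0.ne', ENNReal.rpow_one] at h1
  have hterm : ∀ j, Tendsto (fun k => ∫⁻ z in bergmanBall (a j) r, ‖f k z‖ₑ ^ p ∂μ) atTop
      (𝓝 0) := fun j => by
    obtain ⟨K, hK, hbK⟩ := exists_isCompact_bergmanBall_subset (a j) r
    exact tendsto_of_tendsto_of_tendsto_of_le_of_le tendsto_const_nhds
      (tendsto_setLIntegral_zero hp0 hlim hK) (fun _ => zero_le)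
      fun k => lintegral_mono_set hbK
  -- Here `c j` is the averaged mass at `a j` and `A k j` the share of the norm of `f k` on the
  -- doubled ball.
  have hmain := tendsto_tsum_zero_of_le_mul
    (ENNReal.mul_ne_top hC (ENNReal.mul_ne_top (ENNReal.natCast_ne_top N)
      (ENNReal.rpow_ne_top_of_nonneg hp0.le ENNReal.coe_ne_top)))
    (fun k j => hle μ (a j) (f k) (hf k).1) hsum h hterm
  refine tendsto_of_tendsto_of_tendsto_of_le_of_le tendsto_const_nhds hmain
    (fun _ => zero_le) fun k => ?_
  simp only
  rw [← setLIntegral_univ, ← ha.cover]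
  exact lintegral_iUnion_le _ _

end TubeBergman

end

/-! ### The equivalences and the independence of `p` and `r`. -/

theorem theorem4p2 (m : ℕ) (p r α : ℝ) (hp : 1 < p) (hr : 0 < r) (hα : -1 < α)
    (μ : MeasureTheory.Measure (TubeBergman.tubeDomain m))
    [MeasureTheory.IsFiniteMeasureOnCompacts μ] :
    List.TFAE [
      TubeBergman.IsVanishingCarleson p α μ,
      Tendsto (TubeBergman.berezinIntegral α μ) (TubeBergman.boundaryFilter m) (𝓝 0),
      Tendsto (TubeBergman.ballRatio α r μ) (TubeBergman.boundaryFilter m) (𝓝 0),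
      ∀ a : ℕ → TubeBergman.tubeDomain m, TubeBergman.IsBergmanLattice r a →
        Tendsto (fun k => TubeBergman.ballRatio α r μ (a k)) atTop (𝓝 0),
      ∃ a : ℕ → TubeBergman.tubeDomain m, TubeBergman.IsBergmanLattice r a ∧
        Tendsto (fun k => TubeBergman.ballRatio α r μ (a k)) atTop (𝓝 0)] ∧
    (∀ q : ℝ, 1 < q →
      (TubeBergman.IsVanishingCarleson p α μ ↔ TubeBergman.IsVanishingCarleson q α μ)) ∧
    (∀ s : ℝ, 0 < s →
      (Tendsto (TubeBergman.ballRatio α r μ) (TubeBergman.boundaryFilter m) (𝓝 0) ↔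
        Tendsto (TubeBergman.ballRatio α s μ) (TubeBergman.boundaryFilter m) (𝓝 0))) := by
  have berezin : ∀ q : ℝ, 1 < q → TubeBergman.IsVanishingCarleson q α μ →
      Tendsto (TubeBergman.berezinIntegral α μ) (TubeBergman.boundaryFilter m) (𝓝 0) :=
    fun q hq h => h.tendsto_berezinIntegral (by linarith) hα
  have ratio : ∀ s : ℝ,
      Tendsto (TubeBergman.berezinIntegral α μ) (TubeBergman.boundaryFilter m) (𝓝 0) →
      Tendsto (TubeBergman.ballRatio α s μ) (TubeBergman.boundaryFilter m) (𝓝 0) :=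
    fun s h => TubeBergman.tendsto_ballRatio_of_berezinIntegral s hα h
  have lattice : ∀ s : ℝ, 0 < s →
      Tendsto (TubeBergman.ballRatio α s μ) (TubeBergman.boundaryFilter m) (𝓝 0) →
      ∀ a : ℕ → TubeBergman.tubeDomain m, TubeBergman.IsBergmanLattice s a →
        Tendsto (fun k => TubeBergman.ballRatio α s μ (a k)) atTop (𝓝 0) :=
    fun s hs h a ha =>
      h.comp ((ha.tendsto_cocompact hs).mono_right (TubeBergman.cocompact_le_boundaryFilter m))
  -- Exponent and radius are arbitrary here, so any two of them can be exchanged by passing through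
  -- the Berezin condition.
  have carleson : ∀ q s : ℝ, 1 < q → 0 < s →
      Tendsto (TubeBergman.ballRatio α s μ) (TubeBergman.boundaryFilter m) (𝓝 0) →
      TubeBergman.IsVanishingCarleson q α μ := fun q s hq hs h => by
    obtain ⟨a, ha⟩ := TubeBergman.exists_isBergmanLattice m hs
    exact TubeBergman.isVanishingCarleson_of_lattice hq.le hs hα ha (lattice s hs h a ha)
  refine ⟨?_, fun q hq => ⟨fun h => carleson q r hq hr (ratio r (berezin p hp h)),
    fun h => carleson p r hp hr (ratio r (berezin q hq h))⟩,
    fun s hs => ⟨fun h => ratio s (berezin p hp (carleson p r hp hr h)),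
      fun h => ratio r (berezin p hp (carleson p s hp hs h))⟩⟩
  tfae_have 1 → 2 := berezin p hp
  tfae_have 2 → 3 := ratio r
  tfae_have 3 → 4 := lattice r hr
  tfae_have 4 → 5 := fun h => by
    obtain ⟨a, ha⟩ := TubeBergman.exists_isBergmanLattice m hr
    exact ⟨a, ha, h a ha⟩
  tfae_have 5 → 1 := fun ⟨a, ha, h⟩ =>
    TubeBergman.isVanishingCarleson_of_lattice hp.le hr hα ha h
  tfae_finish
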